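/- **Setting.** For $\phi:[0,1]\to\mathbb R$ and a probability vector $P=(p_1,\dots,p_k)$ put $\theta(P)=\sum_{i=1}^k\phi(p_i)$. Let $\mathcal M_k$ be the set of probability vectors of length $k$. For real $m\ge 0$ define the Poisson minimax risk $$\tilde R^*(m,k;\phi)=\inf_{\hat\theta}\ \sup_{P\in\mathcal M_k}\ \mathbb E\big[(\hat\theta(\tilde N)-\theta(P))^2\big],$$ where $\tilde N=(\tilde N_1,\dots,\tilde N_k)$ has independent coordinates $\tilde N_i\sim\mathrm{Poi}(mp_i)$ and the infimum is over all functions $\hat\theta:\{0,1,2,\dots\}^k\to\mathbb R$. For a real function $f$ on an interval $I$ let $E_L(f,I)=\inf_g\sup_{x\in I}|f(x)-g(x)|$, the infimum being over real polynomials $g$ of degree at most $L$ (and $E_L(f,\emptyset)=0$). The second divergence speed of $\phi$ is $p^\alpha$ if $\phi$ is continuous on $[0,1]$, twice continuously differentiable on $(0,1)$, and there are $W_2>0$, $c_2,c_2'\ge 0$ with $W_2p^{\alpha-2}-c_2'\le|\phi''(p)|\le W_2p^{\alpha-2}+c_2$ for all $p\in(0,1)$. **Theorem.** Let $\alpha>0$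 and let $\phi:[0,1]\to\mathbb R$ have second divergence speed $p^\alpha$. Let $k,L\ge 1$ and $n\ge 0$ be integers and let $d,\lambda>0$ be reals such that at least one of the following holds: 1. $\lambda\le 1/12$ and $2k\,E_L(\phi,[0,\lambda/k])\ge d$; 2. $\lambda\le\sqrt k/12$, $\phi(0)=0$, and there is $\gamma\in(0,1)$ with $k\gamma\le 1$ and $2k\gamma\,E_L(\phi^\star,[\gamma,\lambda/k])\ge d$, where $\phi^\star(x)=\phi(x)/x$. Write $B=\frac{d^2}{32}\Big(\frac78-k\big(\frac{2en\lambda}{Lk}\big)^L\Big)$. There are constants $W,W'>0$ depending only on $\phi$ (not on $n,k,L,d,\lambda$) such that: * if $\alpha\in(0,1)$, then $$\tilde R^*(n/2,k;\phi)\ \ge\ B-Wk^{1-2\alpha}\lambda^{2\alpha}-W'k^{2-2\alpha}e^{-n/32}-4^{2\alpha}W'k^{2-2\alpha}k^{-\alpha}\lambda^{2\alpha};$$ * if $\alpha=1$, then $$\tilde R^*(n/2,k;\phi)\ \ge\ B-\frac{W\lambda^2\ln^2\!\big(\lambda/(ek)\big)}{k}-W'\ln^2(ek)\,e^{-n/32}-16W'\frac{\lambda^2}{k}\ln^2(ek)-W'\Big(1+\frac{4\lambda}{\sqrt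 k}\Big)^2\ln^2\!\Big(1+\frac{4\lambda}{\sqrt k}\Big);$$ * if $\alpha\in(1,2)$, then $$\tilde R^*(n/2,k;\phi)\ \ge\ B-Wk^{1-2\alpha}\lambda^{2\alpha}-W'e^{-n/32}-16W'\frac{\lambda^2}{k}.$$ -/

import Mathlib

open MeasureTheory ProbabilityTheory
open scoped ENNReal

/-- The `ℓ`th divergence speed of `φ` (a function on `[0,1]`; values outside are irrelevant) is
`p ^ α`: `φ` is continuous on `[0,1]`, `ℓ` times continuously differentiable on `(0,1)`, and
`|φ^{(ℓ)}(p)|` equals `W p ^ (α - ℓ)` on `(0,1)` up to additive constants. -/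
def HasDivergenceSpeed (ℓ : ℕ) (α : ℝ) (φ : ℝ → ℝ) : Prop :=
  ContinuousOn φ (Set.Icc 0 1) ∧ ContDiffOn ℝ ℓ φ (Set.Ioo 0 1) ∧
    ∃ W c c' : ℝ, 0 < W ∧ 0 ≤ c ∧ 0 ≤ c' ∧ ∀ p ∈ Set.Ioo (0 : ℝ) 1,
      W * p ^ (-(ℓ : ℝ) + α) - c' ≤ |iteratedDeriv ℓ φ p| ∧
        |iteratedDeriv ℓ φ p| ≤ W * p ^ (-(ℓ : ℝ) + α) + c

/-- The additive functional `θ(P; φ) = ∑ i, φ (p i)`. -/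
noncomputable def additiveFunctional {k : ℕ} (φ : ℝ → ℝ) (P : Fin k → ℝ) : ℝ :=
  ∑ i, φ (P i)

/-- The law of the histogram in the Poisson sampling model with intensity `m`: independent
coordinates, the `i`th one Poisson with mean `m * p i`. -/
noncomputable def poissonSampling {k : ℕ} (m : ℝ) (P : Fin k → ℝ) : Measure (Fin k → ℕ) :=
  Measure.pi fun i => poissonMeasure (m * P i).toNNReal

/-- The quadratic risk at `P` of an estimator of `θ(P; φ)` in the Poisson sampling model. -/
noncomputable def poissonRisk {k : ℕ} (m : ℝ) (φ : ℝ → ℝ) (est : (Fin k → ℕ) → ℝ)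
    (P : Fin k → ℝ) : ℝ≥0∞ :=
  ∫⁻ N, ENNReal.ofReal ((est N - additiveFunctional φ P) ^ 2) ∂(poissonSampling m P)

/-- The minimax quadratic risk in the Poisson sampling model with intensity `m`: infimum over all
estimators of the supremum over all probability vectors on `k` letters. -/
noncomputable def poissonMinimaxRisk (m : ℝ) (k : ℕ) (φ : ℝ → ℝ) : ℝ≥0∞ :=
  ⨅ est : (Fin k → ℕ) → ℝ, ⨆ P ∈ stdSimplex ℝ (Fin k), poissonRisk m φ est P

/-- The error `E_L(f, I)` of best uniform approximation of `f` on `I` by real polynomials of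
degree at most `L`. -/
noncomputable def bestPolyError (L : ℕ) (f : ℝ → ℝ) (I : Set ℝ) : ℝ≥0∞ :=
  ⨅ (g : Polynomial ℝ) (_ : g.natDegree ≤ L), ⨆ x ∈ I, ENNReal.ofReal |f x - g.eval x|

/-- The two alternative conditions relating the separation `d` to the best approximation error of
`φ` on `[0, lam / k]`, respectively of `x ↦ φ x / x` on `[γ, lam / k]`. -/
def SeparationCondition (φ : ℝ → ℝ) (k L : ℕ) (d lam : ℝ) : Prop :=
  (lam ≤ 1 / 12 ∧
      ENNReal.ofReal d ≤ 2 * (k : ℝ≥0∞) * bestPolyError L φ (Set.Icc 0 (lam / k))) ∨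
    (lam ≤ √(k : ℝ) / 12 ∧ φ 0 = 0 ∧ ∃ γ : ℝ, 0 < γ ∧ γ < 1 ∧ (k : ℝ) * γ ≤ 1 ∧
      ENNReal.ofReal d ≤ 2 * (k : ℝ≥0∞) * ENNReal.ofReal γ *
        bestPolyError L (fun x => φ x / x) (Set.Icc γ (lam / k)))

/-! The proof is the method of two fuzzy hypotheses with moment-matched priors. By convex duality, a
large best approximation error yields two finitely supported laws on `[0, lam / k]` with equal
moments up to order `L` and means of `φ` at least `d / k` apart (`exists_atomicLaw_pair`). In the
second alternative duality is applied to `φ x / x`, and the laws are then tilted by `γ / x`. Each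
law defines a random vector: `k - 1` independent coordinates and a constant first one that makes the
expected total equal to 1. Equal moments make the two Poisson mixtures close in total variation
(`tsum_poissonMixture_sub_le`), while the expected functionals differ by at least `d / 2` (for `k ≥
2`).

These vectors have total `s` only close to 1, whereas the risk concerns the simplex. Chebyshev's
inequality confines attention to `s ≥ 4 / 5`, and the estimator is then transported by subsampling:
from a histogram with means `n * P i`, draw a Poisson number of points with mean `n / 2`, without
replacement. Given its size, the histogram is multinomial with probabilities `P i / s`, so the
output is dominated by Poisson sampling at the normalized vector
(`tsum_poissonProdWeight_mul_subsampleKernel_le`). The kernel does not involve `s`, so it can be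
applied to whole mixtures. It fails only if the drawn number exceeds the total, which has
probability at most `exp (-n / 32)`.

What remains is analysis of `φ`: a bound `v` for `|φ - φ 0|` on `[0, lam / k]`, which controls the
variance, and a modulus `H * (x + 1 / k)`, which controls normalization and sums to `2 * H` over a
probability vector. Integrating the bound on the second derivative twice dominates the increments of
`φ` by those of `x ^ α`, `x * (2 - log x)` or `x`, according to `α`, and these have explicit moduli.
-/

/-! ### Poisson weights and sums of independent coordinates. -/

/-- The Poisson probability mass function. -/
noncomputable def poissonWeight (v : ℝ) (j : ℕ) : ℝ≥0∞ :=
  ENNReal.ofReal (Real.exp (-v) * v ^ j / j.factorial)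

/-- The mass function of a vector of independent Poisson variables. -/
noncomputable def poissonProdWeight {k : ℕ} (v : Fin k → ℝ) (N : Fin k → ℕ) : ℝ≥0∞ :=
  ∏ i, poissonWeight (v i) (N i)

lemma tsum_poissonWeight {v : ℝ} (hv : 0 ≤ v) : ∑' j, poissonWeight v j = 1 := by
  have h := hasSum_one_poissonMeasure v.toNNReal
  simp only [Real.coe_toNNReal v hv] at h
  unfold poissonWeight
  rw [← ENNReal.ofReal_tsum_of_nonneg (fun j => by positivity) h.summable, h.tsum_eq,
    ENNReal.ofReal_one]

lemma poissonRisk_eq_tsum {k : ℕ} {m : ℝ} (hm : 0 ≤ m) (φ : ℝ → ℝ) (est : (Fin k → ℕ) → ℝ)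
    {P : Fin k → ℝ} (hP : ∀ i, 0 ≤ P i) :
    poissonRisk m φ est P = ∑' N, ENNReal.ofReal ((est N - additiveFunctional φ P) ^ 2) *
      poissonProdWeight (fun i => m * P i) N := by
  unfold poissonRisk poissonSampling
  rw [lintegral_countable']
  refine tsum_congr fun N => ?_
  congr 1
  rw [Measure.pi_singleton]
  refine Finset.prod_congr rfl fun i _ => ?_
  rw [poissonMeasure_singleton, Real.coe_toNNReal _ (mul_nonneg hm (hP i)), poissonWeight]

/-- Summation over `Fin (k + 1) → ℕ` splits off the first coordinate. -/
lemma tsum_fin_succ {k : ℕ} (F : (Fin (k + 1) → ℕ) → ℝ≥0∞) :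
    ∑' N, F N = ∑' a : ℕ, ∑' N : Fin k → ℕ, F (Fin.cons a N) := by
  rw [← (Fin.consEquiv fun _ : Fin (k + 1) => ℕ).tsum_eq, ENNReal.tsum_prod']
  rfl

/-- For a convolution semigroup of weights on `ℕ`, the sum of independent coordinates has the
weight indexed by the sum of the indices. -/
lemma tsum_prod_mul_sum_of_convolution {X : Type*} [AddCommMonoid X] [PartialOrder X]
    [IsOrderedAddMonoid X] (c : X → ℕ → ℝ≥0∞) (h0 : ∀ h : ℕ → ℝ≥0∞, ∑' T, c 0 T * h T = h 0)
    (hadd : ∀ x y, 0 ≤ x → 0 ≤ y → ∀ T,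
      ∑ p ∈ Finset.HasAntidiagonal.antidiagonal T, c x p.1 * c y p.2 = c (x + y) T)
    {k : ℕ} (x : Fin k → X) (hx : ∀ i, 0 ≤ x i) (h : ℕ → ℝ≥0∞) :
    ∑' N : Fin k → ℕ, (∏ i, c (x i) (N i)) * h (∑ i, N i) = ∑' T, c (∑ i, x i) T * h T := by
  induction k generalizing h with
  | zero => simp [h0, tsum_fintype]
  | succ k ih =>
    rw [tsum_fin_succ]
    simp only [Fin.prod_univ_succ, Fin.cons_zero, Fin.cons_succ, Fin.sum_univ_succ]
    have (a : ℕ) : ∑' N : Fin k → ℕ, c (x 0) a * (∏ i, c (x i.succ) (N i)) * h (a + ∑ i, N i)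
        = ∑' T, c (x 0) a * c (∑ i : Fin k, x i.succ) T * h (a + T) := by
      simp only [mul_assoc, ENNReal.tsum_mul_left]
      rw [ih (fun i => x i.succ) (fun i => hx _) (fun T => h (a + T))]
    simp only [this]
    rw [← ENNReal.tsum_prod (f := fun a T => c (x 0) a * c (∑ i : Fin k, x i.succ) T * h (a + T)),
      ← Finset.HasAntidiagonal.sigmaAntidiagonalEquivProd.tsum_eq, ENNReal.tsum_sigma']
    refine tsum_congr fun T => ?_
    rw [tsum_fintype, ← hadd _ _ (hx 0) (Finset.sum_nonneg fun i _ => hx _), Finset.sum_mul,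
      ← Finset.sum_coe_sort (Finset.HasAntidiagonal.antidiagonal T)]
    refine Finset.sum_congr rfl fun p _ => ?_
    have := Finset.HasAntidiagonal.mem_antidiagonal.1 p.2
    simp [Finset.HasAntidiagonal.sigmaAntidiagonalEquivProd, this]

lemma poissonWeight_convolution {x y : ℝ} (hx : 0 ≤ x) (hy : 0 ≤ y) (T : ℕ) :
    ∑ p ∈ Finset.HasAntidiagonal.antidiagonal T, poissonWeight x p.1 * poissonWeight y p.2
      = poissonWeight (x + y) T := by
  unfold poissonWeight
  rw [Finset.sum_congr rfl fun p _ => (ENNReal.ofReal_mul (by positivity)).symm,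
    ← ENNReal.ofReal_sum_of_nonneg (fun p _ => by positivity)]
  congr 1
  rw [(Commute.all x y).add_pow', Finset.mul_sum, Finset.sum_div]
  refine Finset.sum_congr rfl fun p hp => ?_
  have hp' := Finset.HasAntidiagonal.mem_antidiagonal.1 hp
  have hc : ((T.choose p.1 : ℕ) : ℝ) * (p.1.factorial * p.2.factorial) = T.factorial := by
    rw [← hp', ← mul_assoc, Nat.choose_symm_add]
    exact_mod_cast Nat.add_choose_mul_factorial_mul_factorial p.1 p.2
  rw [neg_add, Real.exp_add, nsmul_eq_mul, ← hc]
  have hc0 : ((T.choose p.1 : ℕ) : ℝ) ≠ 0 := by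
    have := Nat.choose_pos (n := T) (k := p.1) (by omega)
    positivity
  field_simp

lemma poissonWeight_zero_left (j : ℕ) : poissonWeight 0 j = if j = 0 then 1 else 0 := by
  unfold poissonWeight
  split_ifs with h <;> simp [h]

lemma tsum_poissonProdWeight_mul {k : ℕ} {v : Fin k → ℝ} (hv : ∀ i, 0 ≤ v i) (h : ℕ → ℝ≥0∞) :
    ∑' N, poissonProdWeight v N * h (∑ i, N i) = ∑' T, poissonWeight (∑ i, v i) T * h T :=
  tsum_prod_mul_sum_of_convolution poissonWeight
    (fun h => by
      rw [tsum_eq_single 0 fun j hj => by simp [poissonWeight_zero_left, hj]]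
      simp [poissonWeight_zero_left])
    (fun _ _ hx hy => poissonWeight_convolution hx hy) v hv h

lemma tsum_poissonProdWeight {k : ℕ} {v : Fin k → ℝ} (hv : ∀ i, 0 ≤ v i) :
    ∑' N, poissonProdWeight v N = 1 := by
  have := tsum_poissonProdWeight_mul hv (fun _ => 1)
  simpa [tsum_poissonWeight (Finset.sum_nonneg fun i _ => hv i)] using this

/-! ### Subsampling a Poisson histogram. -/

/-- Vandermonde's identity for several factors, in weighted form. -/
lemma tsum_prod_choose_mul {k : ℕ} (n : Fin k → ℕ) (h : ℕ → ℝ≥0∞) :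
    ∑' N : Fin k → ℕ, (∏ i, ((n i).choose (N i) : ℝ≥0∞)) * h (∑ i, N i)
      = ∑' T, ((∑ i, n i).choose T : ℝ≥0∞) * h T :=
  tsum_prod_mul_sum_of_convolution (fun n T => ((n.choose T : ℕ) : ℝ≥0∞))
    (fun h => by
      rw [tsum_eq_single 0 fun j hj => by
        rw [Nat.choose_eq_zero_of_lt (Nat.pos_of_ne_zero hj)]; simp]
      simp)
    (fun x y _ _ T => by rw [Nat.add_choose_eq]; push_cast; rfl) n (fun i => Nat.zero_le _) h

/-- The sub-Markov kernel which draws a Poisson number of points with mean `m` and, if it is at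
most `∑ i, N i`, returns the histogram of a subsample of that size drawn without replacement from
the histogram `N`. -/
noncomputable def subsampleKernel {k : ℕ} (m : ℝ) (N N' : Fin k → ℕ) : ℝ≥0∞ :=
  (∏ i, ((N i).choose (N' i) : ℝ≥0∞)) *
    (poissonWeight m (∑ i, N' i) * ((∑ i, N i).choose (∑ i, N' i) : ℝ≥0∞)⁻¹)

/-- The upper tail of the Poisson distribution. -/
noncomputable def poissonTail (m : ℝ) (T : ℕ) : ℝ≥0∞ :=
  ∑' M, if T < M then poissonWeight m M else 0

/-- By Vandermonde's identity the binomial factors cancel after summation over histograms of a given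
size `M`, so the kernel has mass `P(Poi(m) ≤ ∑ i, N i)`; the tail supplies the rest. -/
lemma one_le_tsum_subsampleKernel_add_poissonTail {k : ℕ} {m : ℝ} (hm : 0 ≤ m) (N : Fin k → ℕ) :
    1 ≤ ∑' N', subsampleKernel m N N' + poissonTail m (∑ i, N i) := by
  unfold subsampleKernel poissonTail
  rw [tsum_prod_choose_mul N fun M => poissonWeight m M * ((∑ i, N i).choose M : ℝ≥0∞)⁻¹,
    ← ENNReal.tsum_add, ← tsum_poissonWeight hm]
  refine ENNReal.tsum_le_tsum fun M => ?_
  split_ifs with h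
  · exact le_add_self
  · have hc : ((∑ i, N i).choose M : ℝ≥0∞) ≠ 0 := by
      exact_mod_cast (Nat.choose_pos (not_lt.1 h)).ne'
    rw [mul_left_comm, ENNReal.mul_inv_cancel hc (ENNReal.natCast_ne_top _)]
    simp

lemma poissonWeight_add_mul_choose {v : ℝ} (hv : 0 ≤ v) (a b : ℕ) :
    poissonWeight v (a + b) * ((a + b).choose a : ℝ≥0∞)
      = ENNReal.ofReal (v ^ a / a.factorial) * poissonWeight v b := by
  unfold poissonWeight
  rw [← ENNReal.ofReal_natCast, ← ENNReal.ofReal_mul (by positivity),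
    ← ENNReal.ofReal_mul (by positivity)]
  congr 1
  have hc : (((a + b).choose a : ℕ) : ℝ) * (a.factorial * b.factorial) = (a + b).factorial := by
    rw [← mul_assoc, Nat.choose_symm_add]
    exact_mod_cast Nat.add_choose_mul_factorial_mul_factorial a b
  have hc0 : (((a + b).choose a : ℕ) : ℝ) ≠ 0 := by
    have := Nat.choose_pos (n := a + b) (k := a) (by omega)
    positivity
  rw [← hc, pow_add]
  field_simp

/-- Each term is `M! / v ^ M` times the Poisson weight at `M + T`, so the sum is that factor times
`P(Poi(v) ≥ M) ≤ 1`. The loss here is exactly the event that subsampling is impossible. -/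
lemma tsum_poissonWeight_mul_inv_choose_le {v : ℝ} (hv : 0 < v) (M : ℕ) :
    ∑' T, poissonWeight v T * ((M + T).choose M : ℝ≥0∞)⁻¹
      ≤ ENNReal.ofReal (M.factorial / v ^ M) := by
  have (T : ℕ) : poissonWeight v T * ((M + T).choose M : ℝ≥0∞)⁻¹
      = ENNReal.ofReal (M.factorial / v ^ M) * poissonWeight v (M + T) := by
    have hc0 : ((M + T).choose M : ℝ≥0∞) ≠ 0 := by
      exact_mod_cast (Nat.choose_pos (by omega)).ne'
    have h1 : ENNReal.ofReal (M.factorial / v ^ M) * ENNReal.ofReal (v ^ M / M.factorial) = 1 := by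
      rw [← ENNReal.ofReal_mul (by positivity), ← ENNReal.ofReal_one]
      congr 1
      field_simp
    rw [← one_mul (poissonWeight v T), ← h1, mul_assoc (ENNReal.ofReal _),
      ← poissonWeight_add_mul_choose hv.le, mul_assoc, mul_assoc,
      ENNReal.mul_inv_cancel hc0 (ENNReal.natCast_ne_top _), mul_one]
  simp only [this]
  rw [ENNReal.tsum_mul_left]
  refine mul_le_of_le_one_right' ?_
  rw [← tsum_poissonWeight hv.le]
  exact ENNReal.tsum_comp_le_tsum_of_injective (add_right_injective M) _

/-- Writing `N = N' + D` separates the product weights into a factor of `N'` and the Poisson weights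
of `D`, which enters otherwise only through its total. Summing over that total leaves the
multinomial law with probabilities `P i / s`, mixed over a Poisson size. The case `n = 0` is
separate because the general argument divides by `n * s`. -/
lemma tsum_poissonProdWeight_mul_subsampleKernel_le {k : ℕ} {n m : ℝ} (hn : 0 ≤ n) (hm : 0 ≤ m)
    (hnm : n = 0 → m = 0) {P : Fin k → ℝ} (hP : ∀ i, 0 ≤ P i) (hs : 0 < ∑ i, P i)
    (N' : Fin k → ℕ) :
    ∑' N, poissonProdWeight (fun i => n * P i) N * subsampleKernel m N N'
      ≤ poissonProdWeight (fun i => m * (P i / ∑ i, P i)) N' := by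
  have hnP : ∀ i, 0 ≤ n * P i := fun i => mul_nonneg hn (hP i)
  set M := ∑ i, N' i with hM
  rcases hn.eq_or_lt with rfl | hn
  · obtain rfl := hnm rfl
    by_cases hN : ∀ i, N' i = 0
    · obtain rfl : N' = 0 := funext hN
      have := tsum_poissonProdWeight hnP
      simp [subsampleKernel, poissonWeight_zero_left, poissonProdWeight] at this ⊢
      exact this.le
    · have : M ≠ 0 := by
        contrapose! hN
        simpa [hM, Finset.sum_eq_zero_iff] using hN
      simp [subsampleKernel, poissonWeight_zero_left, ← hM, this]
  set s := ∑ i, P i with hs'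
  have hsupp : Function.support
      (fun N => poissonProdWeight (fun i => n * P i) N * subsampleKernel m N N')
      ⊆ Set.range (fun D : Fin k → ℕ => N' + D) := by
    intro N hN
    refine ⟨N - N', ?_⟩
    ext i
    simp only [Pi.add_apply, Pi.sub_apply]
    by_contra hlt
    apply hN
    have : (∏ i, ((N i).choose (N' i) : ℝ≥0∞)) = 0 :=
      Finset.prod_eq_zero (Finset.mem_univ i) (by
        rw [Nat.choose_eq_zero_of_lt (by omega)]; simp)
    simp [subsampleKernel, this]
  rw [← (add_right_injective N').tsum_eq hsupp]
  have key (D : Fin k → ℕ) :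
      poissonProdWeight (fun i => n * P i) (N' + D) * subsampleKernel m (N' + D) N'
      = (poissonWeight m M * ∏ i, ENNReal.ofReal ((n * P i) ^ N' i / (N' i).factorial)) *
        (poissonProdWeight (fun i => n * P i) D *
          ((M + ∑ i, D i).choose M : ℝ≥0∞)⁻¹) := by
    have h1 : poissonProdWeight (fun i => n * P i) (N' + D) *
        ∏ i, (((N' + D) i).choose (N' i) : ℝ≥0∞)
        = (∏ i, ENNReal.ofReal ((n * P i) ^ N' i / (N' i).factorial)) *
          poissonProdWeight (fun i => n * P i) D := by
      unfold poissonProdWeight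
      rw [← Finset.prod_mul_distrib, ← Finset.prod_mul_distrib]
      exact Finset.prod_congr rfl fun i _ => poissonWeight_add_mul_choose (hnP i) _ _
    unfold subsampleKernel
    rw [← mul_assoc, h1, ← hM]
    simp only [Pi.add_apply, Finset.sum_add_distrib, ← hM]
    ring
  simp only [key]
  rw [ENNReal.tsum_mul_left,
    tsum_poissonProdWeight_mul hnP (fun T => ((M + T).choose M : ℝ≥0∞)⁻¹), ← Finset.mul_sum]
  refine (mul_le_mul_right (tsum_poissonWeight_mul_inv_choose_le (mul_pos hn hs) M) _).trans
    (le_of_eq ?_)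
  unfold poissonProdWeight poissonWeight
  have e0 : ∀ i ∈ Finset.univ, (0 : ℝ) ≤ (n * P i) ^ N' i / (N' i).factorial :=
    fun i _ => div_nonneg (pow_nonneg (hnP i) _) (by positivity)
  rw [← ENNReal.ofReal_prod_of_nonneg e0, ← ENNReal.ofReal_mul (by positivity),
    ← ENNReal.ofReal_mul (mul_nonneg (by positivity) (Finset.prod_nonneg e0)),
    ← ENNReal.ofReal_prod_of_nonneg fun i _ => by have := hP i; positivity]
  congr 1
  simp only [Finset.prod_div_distrib, Finset.prod_mul_distrib, mul_pow, ← Real.exp_sum,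
    Finset.prod_pow_eq_pow_sum, div_pow, ← hM, Finset.sum_neg_distrib, ← Finset.mul_sum,
    ← Finset.sum_div, ← hs', div_self hs.ne', mul_one]
  have : (∏ i, ((N' i).factorial : ℝ)) ≠ 0 := by positivity
  field_simp

/-! ### Poisson tails. -/

lemma tsum_poissonWeight_mul_pow {v z : ℝ} (hv : 0 ≤ v) (hz : 0 ≤ z) :
    ∑' j, poissonWeight v j * ENNReal.ofReal (z ^ j) = ENNReal.ofReal (Real.exp (v * (z - 1))) := by
  have (j : ℕ) : poissonWeight v j * ENNReal.ofReal (z ^ j)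
      = ENNReal.ofReal (Real.exp (v * (z - 1))) * poissonWeight (v * z) j := by
    unfold poissonWeight
    rw [← ENNReal.ofReal_mul (by positivity), ← ENNReal.ofReal_mul (by positivity)]
    congr 1
    rw [← mul_div_assoc, ← mul_assoc, ← Real.exp_add, mul_pow]
    ring_nf
  simp only [this]
  rw [ENNReal.tsum_mul_left, tsum_poissonWeight (mul_nonneg hv hz), mul_one]

/-- Chernoff's bound: the indicator of `T < M` is at most `z ^ M * z⁻¹ ^ T`. -/
lemma poissonTail_le {m z : ℝ} (hm : 0 ≤ m) (hz : 1 ≤ z) (T : ℕ) :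
    poissonTail m T ≤ ENNReal.ofReal (Real.exp (m * (z - 1))) * ENNReal.ofReal (z⁻¹ ^ T) := by
  rw [← tsum_poissonWeight_mul_pow hm (by linarith), ← ENNReal.tsum_mul_right]
  refine ENNReal.tsum_le_tsum fun M => ?_
  split_ifs with h
  · rw [mul_assoc, ← ENNReal.ofReal_mul (by positivity)]
    refine le_mul_of_one_le_right' ?_
    rw [ENNReal.one_le_ofReal, inv_pow, ← div_eq_mul_inv, one_le_div (by positivity)]
    exact pow_le_pow_right₀ hz h.le
  · exact zero_le

/-- A Poisson variable with mean `n / 2` exceeds an independent one with mean at least `4 n / 5`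
with exponentially small probability. -/
lemma tsum_poissonWeight_mul_poissonTail_le {n v : ℝ} (hn : 0 ≤ n) (hv : n * (4 / 5) ≤ v) :
    ∑' T, poissonWeight v T * poissonTail (n / 2) T ≤ ENNReal.ofReal (Real.exp (-n / 32)) := by
  have hv0 : 0 ≤ v := by linarith
  -- With `z = 5 / 4` the exponent is `n / 8 - v / 5`, at most `-(7 / 200) * n ≤ -n / 32`.
  calc ∑' T, poissonWeight v T * poissonTail (n / 2) T
      ≤ ∑' T, ENNReal.ofReal (Real.exp (n / 2 * (5 / 4 - 1))) *
          (poissonWeight v T * ENNReal.ofReal ((5 / 4 : ℝ)⁻¹ ^ T)) := by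
        refine ENNReal.tsum_le_tsum fun T => ?_
        rw [mul_left_comm]
        exact mul_le_mul_right (poissonTail_le (by linarith) (by norm_num) T) _
    _ = ENNReal.ofReal (Real.exp (n / 2 * (5 / 4 - 1) + v * ((5 / 4)⁻¹ - 1))) := by
        rw [ENNReal.tsum_mul_left, tsum_poissonWeight_mul_pow hv0 (by norm_num),
          ← ENNReal.ofReal_mul (by positivity), Real.exp_add]
    _ ≤ _ := by
        apply ENNReal.ofReal_le_ofReal
        rw [Real.exp_le_exp]
        linarith

/-! ### Total variation of product laws. -/

lemma tsum_prod_eq_one {k : ℕ} (f : Fin k → ℕ → ℝ≥0∞) (hf : ∀ i, ∑' j, f i j = 1) :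
    ∑' N : Fin k → ℕ, ∏ i, f i (N i) = 1 := by
  induction k with
  | zero => simp [tsum_fintype]
  | succ k ih =>
    rw [tsum_fin_succ]
    simp only [Fin.prod_univ_succ, Fin.cons_zero, Fin.cons_succ, ENNReal.tsum_mul_left]
    rw [ih (fun i => f i.succ) fun i => hf _]
    simpa using hf 0

/-- The total variation distance is subadditive over products. -/
lemma tsum_prod_sub_prod_le {k : ℕ} (f g : Fin k → ℕ → ℝ≥0∞) (hf : ∀ i, ∑' j, f i j = 1)
    (hg : ∀ i, ∑' j, g i j = 1) :
    ∑' N : Fin k → ℕ, (∏ i, f i (N i) - ∏ i, g i (N i)) ≤ ∑ i, ∑' j, (f i j - g i j) := by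
  induction k with
  | zero => simp
  | succ k ih =>
    rw [tsum_fin_succ]
    simp only [Fin.prod_univ_succ, Fin.cons_zero, Fin.cons_succ, Fin.sum_univ_succ]
    have hb := tsum_prod_eq_one (fun i : Fin k => f i.succ) fun i => hf _
    -- Subtraction in `ℝ≥0∞` is truncated, so these sums are total variation distances of
    -- probability weights. One factor is exchanged at a time.
    calc _ ≤ ∑' (a : ℕ) (N : Fin k → ℕ), ((f 0 a - g 0 a) * ∏ i : Fin k, f i.succ (N i)
            + g 0 a * (∏ i : Fin k, f i.succ (N i) - ∏ i : Fin k, g i.succ (N i))) := by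
          refine ENNReal.tsum_le_tsum fun a => ENNReal.tsum_le_tsum fun N => ?_
          rw [tsub_le_iff_right]
          calc _ ≤ (f 0 a - g 0 a + g 0 a) * ∏ i : Fin k, f i.succ (N i) := by
                gcongr; exact le_tsub_add
            _ = (f 0 a - g 0 a) * ∏ i : Fin k, f i.succ (N i)
                + g 0 a * ∏ i : Fin k, f i.succ (N i) := add_mul _ _ _
            _ ≤ (f 0 a - g 0 a) * ∏ i : Fin k, f i.succ (N i)
                + g 0 a * ((∏ i : Fin k, f i.succ (N i) - ∏ i : Fin k, g i.succ (N i)) +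
                  ∏ i : Fin k, g i.succ (N i)) := by
                gcongr; exact le_tsub_add
            _ = _ := by ring
      _ = ∑' a, (f 0 a - g 0 a) + ∑' N : Fin k → ℕ,
            (∏ i : Fin k, f i.succ (N i) - ∏ i : Fin k, g i.succ (N i)) := by
          simp only [ENNReal.tsum_add, ENNReal.tsum_mul_left, ENNReal.tsum_mul_right, hb, hg,
            mul_one, one_mul]
      _ ≤ _ := by gcongr; exact ih _ _ (fun i => hf _) (fun i => hg _)

/-! ### Finitely supported laws and their Poisson mixtures. -/

/-- A finitely supported probability distribution on a set of reals. -/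
structure AtomicLaw (I : Set ℝ) where
  ι : Type
  fintype : Fintype ι
  w : ι → ℝ
  x : ι → ℝ
  w_nonneg : ∀ a, 0 ≤ w a
  w_sum : ∑ a, w a = 1
  x_mem : ∀ a, x a ∈ I

namespace AtomicLaw

attribute [instance] AtomicLaw.fintype

variable {I : Set ℝ}

/-- The expectation of a function. -/
noncomputable def mean (A : AtomicLaw I) (f : ℝ → ℝ) : ℝ := ∑ a, A.w a * f (A.x a)

lemma mean_const (A : AtomicLaw I) (c : ℝ) : A.mean (fun _ => c) = c := by
  simp [mean, ← Finset.sum_mul, A.w_sum]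

lemma mean_mono (A : AtomicLaw I) {f g : ℝ → ℝ} (h : ∀ x ∈ I, f x ≤ g x) :
    A.mean f ≤ A.mean g :=
  Finset.sum_le_sum fun a _ => mul_le_mul_of_nonneg_left (h _ (A.x_mem a)) (A.w_nonneg a)

lemma mean_nonneg (A : AtomicLaw I) {f : ℝ → ℝ} (h : ∀ x ∈ I, 0 ≤ f x) : 0 ≤ A.mean f :=
  Finset.sum_nonneg fun a _ => mul_nonneg (A.w_nonneg a) (h _ (A.x_mem a))

lemma mean_add (A : AtomicLaw I) (f g : ℝ → ℝ) :
    A.mean (fun x => f x + g x) = A.mean f + A.mean g := by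
  simp [mean, mul_add, Finset.sum_add_distrib]

lemma mean_sub (A : AtomicLaw I) (f g : ℝ → ℝ) :
    A.mean (fun x => f x - g x) = A.mean f - A.mean g := by
  simp [mean, mul_sub, Finset.sum_sub_distrib]

lemma mean_const_mul (A : AtomicLaw I) (c : ℝ) (f : ℝ → ℝ) :
    A.mean (fun x => c * f x) = c * A.mean f := by
  simp [mean, Finset.mul_sum, mul_left_comm]

/-- The mass function of a Poisson variable with random mean `n * X`, `X` distributed as `A`. -/
noncomputable def poissonMixture (A : AtomicLaw I) (n : ℝ) (j : ℕ) : ℝ≥0∞ :=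
  ∑ a, ENNReal.ofReal (A.w a) * poissonWeight (n * A.x a) j

lemma tsum_poissonMixture (A : AtomicLaw I) (hI : ∀ x ∈ I, 0 ≤ x) {n : ℝ} (hn : 0 ≤ n) :
    ∑' j, A.poissonMixture n j = 1 := by
  unfold poissonMixture
  rw [Summable.tsum_finsetSum fun _ _ => ENNReal.summable]
  simp only [ENNReal.tsum_mul_left]
  rw [Finset.sum_congr rfl fun a _ => by
    rw [tsum_poissonWeight (mul_nonneg hn (hI _ (A.x_mem a))), mul_one],
    ← ENNReal.ofReal_sum_of_nonneg fun a _ => A.w_nonneg a, A.w_sum, ENNReal.ofReal_one]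

lemma poissonMixture_eq_ofReal (A : AtomicLaw I) (hI : ∀ x ∈ I, 0 ≤ x) {n : ℝ} (hn : 0 ≤ n)
    (j : ℕ) : A.poissonMixture n j
      = ENNReal.ofReal (A.mean fun x => Real.exp (-(n * x)) * (n * x) ^ j / j.factorial) := by
  unfold poissonMixture mean poissonWeight
  have h0 : ∀ a, 0 ≤ n * A.x a := fun a => mul_nonneg hn (hI _ (A.x_mem a))
  rw [ENNReal.ofReal_sum_of_nonneg fun a _ => mul_nonneg (A.w_nonneg a) (by
    have := h0 a; positivity)]
  exact Finset.sum_congr rfl fun a _ => (ENNReal.ofReal_mul (A.w_nonneg a)).symm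

/-- Expanding the exponential expresses the mixture's mass at `j` through the moments of order `i +
j`, so matching moments cancel every term with `i + j ≤ L`. -/
lemma hasSum_mean_poisson (A : AtomicLaw I) (n : ℝ) (j : ℕ) :
    HasSum (fun i : ℕ => (-1) ^ i * n ^ (i + j) / (i.factorial * j.factorial) *
      A.mean (fun x => x ^ (i + j)))
      (A.mean fun x => Real.exp (-(n * x)) * (n * x) ^ j / j.factorial) := by
  have h (a : A.ι) : HasSum (fun i : ℕ => A.w a * ((-(n * A.x a)) ^ i / i.factorial *
      ((n * A.x a) ^ j / j.factorial)))
      (A.w a * (Real.exp (-(n * A.x a)) * ((n * A.x a) ^ j / j.factorial))) := by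
    have := NormedSpace.expSeries_div_hasSum_exp (-(n * A.x a))
    rw [← Real.exp_eq_exp_ℝ] at this
    exact (this.mul_right _).mul_left _
  have := hasSum_sum (s := Finset.univ) fun a _ => h a
  unfold mean
  convert! this using 1
  · ext i
    rw [Finset.mul_sum]
    refine Finset.sum_congr rfl fun a _ => ?_
    rw [neg_pow (n * A.x a), mul_pow, mul_pow, pow_add]
    simp only [pow_add]
    field_simp
  · exact Finset.sum_congr rfl fun a _ => by simp only [mul_div_assoc]

lemma abs_mean_pow_sub_le {b : ℝ} (A B : AtomicLaw (Set.Icc 0 b)) (l : ℕ) :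
    |A.mean (fun x => x ^ l) - B.mean (fun x => x ^ l)| ≤ b ^ l := by
  have h (A : AtomicLaw (Set.Icc 0 b)) : 0 ≤ A.mean (fun x => x ^ l) ∧
      A.mean (fun x => x ^ l) ≤ b ^ l := by
    constructor
    · simpa [mean_const] using A.mean_mono (f := fun _ => 0) fun x hx => pow_nonneg hx.1 l
    · simpa [mean_const] using A.mean_mono (g := fun _ => b ^ l)
        fun x hx => pow_le_pow_left₀ hx.1 hx.2 l
  rw [abs_le]
  constructor <;> linarith [(h A).1, (h A).2, (h B).1, (h B).2]

/-- Only orders above `L` survive; inserting the factor `z ^ (i + j - L) ≥ 1` there lets the sum be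
completed to a full exponential series. -/
lemma mean_poisson_sub_le {b : ℝ} (A B : AtomicLaw (Set.Icc 0 b)) (hb : 0 ≤ b) {n z : ℝ}
    (hn : 0 ≤ n) (hz : 1 ≤ z) {L : ℕ}
    (hmom : ∀ l ≤ L, A.mean (fun x => x ^ l) = B.mean (fun x => x ^ l)) (j : ℕ) :
    A.mean (fun x => Real.exp (-(n * x)) * (n * x) ^ j / j.factorial)
      - B.mean (fun x => Real.exp (-(n * x)) * (n * x) ^ j / j.factorial)
      ≤ z⁻¹ ^ L * Real.exp (n * b * z) * ((n * b * z) ^ j / j.factorial) := by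
  have h1 := (A.hasSum_mean_poisson n j).sub (B.hasSum_mean_poisson n j)
  have h2 := ((NormedSpace.expSeries_div_hasSum_exp (n * b * z)).mul_left (z⁻¹ ^ L)).mul_right
    ((n * b * z) ^ j / j.factorial)
  rw [← Real.exp_eq_exp_ℝ] at h2
  refine hasSum_le (fun i => ?_) h1 h2
  have hz0 : 0 < z := by linarith
  rw [← mul_sub]
  by_cases hl : i + j ≤ L
  · rw [hmom _ hl, sub_self, mul_zero]
    positivity
  · refine (le_abs_self _).trans ?_
    rw [abs_mul, abs_div, abs_mul, abs_pow, abs_neg, abs_one, one_pow, one_mul,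
      abs_of_nonneg (pow_nonneg hn _), abs_of_nonneg (by positivity : (0 : ℝ) ≤
        (i.factorial : ℝ) * j.factorial)]
    have hz1 : 1 ≤ z⁻¹ ^ L * z ^ (i + j) := by
      rw [inv_pow, inv_mul_eq_div, one_le_div (by positivity)]
      exact pow_le_pow_right₀ hz (by omega)
    calc _ ≤ n ^ (i + j) / (i.factorial * j.factorial) * b ^ (i + j) := by
          gcongr; exact abs_mean_pow_sub_le A B _
      _ ≤ n ^ (i + j) / (i.factorial * j.factorial) * b ^ (i + j) * (z⁻¹ ^ L * z ^ (i + j)) :=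
          le_mul_of_one_le_right (by positivity) hz1
      _ = _ := by
          rw [mul_pow, mul_pow, mul_pow, mul_pow, pow_add, pow_add, pow_add]
          field_simp

/-- Poisson mixtures whose mixing distributions share `L` moments are close in total variation. -/
lemma tsum_poissonMixture_sub_le {b : ℝ} (A B : AtomicLaw (Set.Icc 0 b)) (hb : 0 ≤ b) {n : ℝ}
    (hn : 0 ≤ n) {L : ℕ} (hL : 0 < L)
    (hmom : ∀ l ≤ L, A.mean (fun x => x ^ l) = B.mean (fun x => x ^ l)) :
    ∑' j, (A.poissonMixture n j - B.poissonMixture n j)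
      ≤ ENNReal.ofReal ((2 * Real.exp 1 * (n * b) / L) ^ L) := by
  have hI : ∀ x ∈ Set.Icc 0 b, 0 ≤ x := fun x hx => hx.1
  have hL' : (0 : ℝ) < L := by exact_mod_cast hL
  have he : (1 : ℝ) ≤ Real.exp 1 := Real.one_le_exp (by norm_num)
  rcases (mul_nonneg hn hb).eq_or_lt with h0 | h0
  · have hx (A : AtomicLaw (Set.Icc 0 b)) (a : A.ι) : n * A.x a = 0 :=
      le_antisymm ((mul_le_mul_of_nonneg_left (A.x_mem a).2 hn).trans h0.ge)
        (mul_nonneg hn (A.x_mem a).1)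
    have hq (A : AtomicLaw (Set.Icc 0 b)) (j : ℕ) : A.poissonMixture n j = poissonWeight 0 j := by
      unfold poissonMixture
      simp only [hx]
      rw [← Finset.sum_mul, ← ENNReal.ofReal_sum_of_nonneg fun a _ => A.w_nonneg a, A.w_sum]
      simp
    simp [hq]
  -- After summation over `j` the bound is `z⁻¹ ^ L * exp (2 * n * b * z)`, minimized at `z = L / (2
  -- * n * b)`. If this is below 1, the claimed bound exceeds 1 and is trivial.
  by_cases hM : 2 * (n * b) ≤ L
  · set z := L / (2 * (n * b)) with hz
    have hz1 : 1 ≤ z := by rwa [hz, one_le_div (by positivity)]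
    have hz0 : 0 < z := by linarith
    have hs := NormedSpace.expSeries_div_hasSum_exp (n * b * z)
    rw [← Real.exp_eq_exp_ℝ] at hs
    have hs2 := hs.mul_left (z⁻¹ ^ L * Real.exp (n * b * z))
    calc ∑' j, (A.poissonMixture n j - B.poissonMixture n j)
        ≤ ∑' j : ℕ, ENNReal.ofReal
            (z⁻¹ ^ L * Real.exp (n * b * z) * ((n * b * z) ^ j / j.factorial)) := by
          refine ENNReal.tsum_le_tsum fun j => ?_
          rw [A.poissonMixture_eq_ofReal hI hn, B.poissonMixture_eq_ofReal hI hn,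
            ← ENNReal.ofReal_sub]
          · exact ENNReal.ofReal_le_ofReal (mean_poisson_sub_le A B hb hn hz1 hmom j)
          · exact B.mean_nonneg fun x hx => by
              have := mul_nonneg hn hx.1
              positivity
      _ = ENNReal.ofReal (z⁻¹ ^ L * Real.exp (n * b * z) * Real.exp (n * b * z)) := by
          rw [← ENNReal.ofReal_tsum_of_nonneg (fun j => by positivity) hs2.summable, hs2.tsum_eq]
      _ = _ := by
          congr 1
          rw [mul_assoc, ← Real.exp_add]
          have : n * b * z + n * b * z = L * 1 := by
            rw [hz, mul_one, ← two_mul, ← mul_assoc, mul_div_cancel₀ _ (by positivity)]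
          rw [this, Real.exp_nat_mul, ← mul_pow]
          congr 1
          rw [hz]
          field_simp
  · calc ∑' j, (A.poissonMixture n j - B.poissonMixture n j)
        ≤ ∑' j, A.poissonMixture n j := ENNReal.tsum_le_tsum fun j => tsub_le_self
      _ = 1 := A.tsum_poissonMixture hI hn
      _ ≤ _ := by
          rw [ENNReal.one_le_ofReal]
          apply one_le_pow₀
          rw [one_le_div hL']
          nlinarith

end AtomicLaw

/-! ### Random vectors with independent coordinates. -/

namespace AtomicLaw

variable {I : Set ℝ}

/-- The product weights on `Fin k → A.ι`. -/
def prodWeight (A : AtomicLaw I) {k : ℕ} (a : Fin k → A.ι) : ℝ := ∏ i, A.w (a i)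

lemma prodWeight_nonneg (A : AtomicLaw I) {k : ℕ} (a : Fin k → A.ι) : 0 ≤ A.prodWeight a :=
  Finset.prod_nonneg fun _ _ => A.w_nonneg _

lemma sum_prodWeight_mul_prod (A : AtomicLaw I) {k : ℕ} (F : Fin k → A.ι → ℝ) :
    ∑ a : Fin k → A.ι, A.prodWeight a * ∏ i, F i (a i) = ∏ i, ∑ b, A.w b * F i b := by
  classical
  rw [Finset.prod_univ_sum, Fintype.piFinset_univ]
  exact Finset.sum_congr rfl fun a _ => Finset.prod_mul_distrib.symm

lemma sum_prodWeight (A : AtomicLaw I) (k : ℕ) : ∑ a : Fin k → A.ι, A.prodWeight a = 1 := by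
  simpa [A.w_sum] using A.sum_prodWeight_mul_prod (k := k) fun _ _ => 1

/-- The variance of a sum of independent centred variables. -/
lemma sum_prodWeight_mul_sum_sq (A : AtomicLaw I) {k : ℕ} (h : Fin k → A.ι → ℝ)
    (h0 : ∀ i, ∑ b, A.w b * h i b = 0) :
    ∑ a : Fin k → A.ι, A.prodWeight a * (∑ i, h i (a i)) ^ 2
      = ∑ i, ∑ b, A.w b * h i b ^ 2 := by
  classical
  have hd (i : Fin k) : ∑ a : Fin k → A.ι, A.prodWeight a * h i (a i) ^ 2
      = ∑ b, A.w b * h i b ^ 2 := by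
    have := A.sum_prodWeight_mul_prod fun l b => if l = i then h i b ^ 2 else 1
    simp only [Finset.prod_ite_eq', Finset.mem_univ, if_true] at this
    rw [this, Finset.prod_eq_single i (fun l _ hl => by simp [hl, A.w_sum]) (by simp)]
    simp
  have ho (i j : Fin k) (hij : j ≠ i) :
      ∑ a : Fin k → A.ι, A.prodWeight a * (h i (a i) * h j (a j)) = 0 := by
    have := A.sum_prodWeight_mul_prod fun l b =>
      (if l = i then h i b else 1) * (if l = j then h j b else 1)
    simp only [Finset.prod_mul_distrib, Finset.prod_ite_eq', Finset.mem_univ, if_true] at this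
    rw [this]
    exact Finset.prod_eq_zero (Finset.mem_univ i) (by simp [hij.symm, h0])
  simp only [sq (∑ i, h i _), Finset.sum_mul_sum]
  simp only [Finset.mul_sum]
  rw [Finset.sum_comm]
  refine Finset.sum_congr rfl fun i _ => ?_
  rw [Finset.sum_comm, Finset.sum_eq_single i (fun j _ hj => ho i j hj) (by simp), ← hd]
  simp only [sq]

lemma mean_sub_mean_sq_le (A : AtomicLaw I) (f : ℝ → ℝ) (c : ℝ) :
    A.mean (fun x => (f x - A.mean f) ^ 2) ≤ A.mean (fun x => (f x - c) ^ 2) := by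
  have h (c : ℝ) : A.mean (fun x => (f x - c) ^ 2)
      = A.mean (fun x => f x ^ 2) - 2 * c * A.mean f + c ^ 2 := by
    have : (fun x => (f x - c) ^ 2) = fun x => (f x ^ 2 - 2 * c * f x) + c ^ 2 := by
      ext x; ring
    rw [this, mean_add, mean_sub, mean_const_mul, mean_const]
  rw [h, h]
  nlinarith [sq_nonneg (A.mean f - c)]

/-- The vector whose first coordinate is `c` and whose others are the atoms indexed by `a`. -/
def vector (A : AtomicLaw I) (c : ℝ) {r : ℕ} (a : Fin (r + 1) → A.ι) (i : Fin (r + 1)) : ℝ :=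
  if i = 0 then c else A.x (a i)

/-- The expectation of an additive functional of `A.vector c a` under the product weights. -/
noncomputable def vectorMean (A : AtomicLaw I) (c : ℝ) (r : ℕ) (f : ℝ → ℝ) : ℝ :=
  f c + r * A.mean f

/-- The first coordinate is constant, so the variance comes from `r` independent copies of `f`. The
centre `y` is free because the mean minimizes the mean square deviation; it is later `b / 2` or `φ
0`. -/
lemma sum_prodWeight_mul_vector_sq_le (A : AtomicLaw I) (c : ℝ) (r : ℕ) (f : ℝ → ℝ) (y : ℝ) :
    ∑ a : Fin (r + 1) → A.ι, A.prodWeight a *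
      (∑ i, f (A.vector c a i) - A.vectorMean c r f) ^ 2
      ≤ r * A.mean (fun x => (f x - y) ^ 2) := by
  have := A.sum_prodWeight_mul_sum_sq (k := r + 1)
    (fun i b => if i = 0 then 0 else f (A.x b) - A.mean f) (fun i => by
      split_ifs
      · simp
      · simp [mul_sub, Finset.sum_sub_distrib, ← Finset.sum_mul, A.w_sum, mean])
  calc _ = r * A.mean (fun x => (f x - A.mean f) ^ 2) := by
        refine Eq.trans (Finset.sum_congr rfl fun a _ => ?_) (this.trans ?_)
        · congr 2
          simp [Fin.sum_univ_succ, vector, vectorMean]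
        · simp [Fin.sum_univ_succ, mean]
    _ ≤ _ := by gcongr; exact A.mean_sub_mean_sq_le f y

/-- The mass function of the histogram with Poisson coordinates of means `n * A.vector c a i`,
averaged over `a`. -/
lemma sum_prodWeight_mul_poissonProdWeight (A : AtomicLaw I) (c n : ℝ) {r : ℕ}
    (N : Fin (r + 1) → ℕ) :
    ∑ a : Fin (r + 1) → A.ι, ENNReal.ofReal (A.prodWeight a) *
      poissonProdWeight (fun i => n * A.vector c a i) N
      = ∏ i, if i = 0 then poissonWeight (n * c) (N i) else A.poissonMixture n (N i) := by
  classical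
  have h (i : Fin (r + 1)) :
      (if i = 0 then poissonWeight (n * c) (N i) else A.poissonMixture n (N i))
      = ∑ b, ENNReal.ofReal (A.w b) * poissonWeight (n * if i = 0 then c else A.x b) (N i) := by
    split_ifs
    · rw [← Finset.sum_mul, ← ENNReal.ofReal_sum_of_nonneg fun a _ => A.w_nonneg a, A.w_sum]
      simp
    · rfl
  simp only [h]
  rw [Finset.prod_univ_sum, Fintype.piFinset_univ]
  refine Finset.sum_congr rfl fun a _ => ?_
  rw [Finset.prod_mul_distrib, prodWeight, ENNReal.ofReal_prod_of_nonneg fun i _ => A.w_nonneg _]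
  rfl

end AtomicLaw

/-! ### Subsampled loss and the two fuzzy hypotheses. -/

lemma ofReal_sub_sq_le (x θ μ : ℝ) :
    ENNReal.ofReal ((x - μ) ^ 2)
      ≤ 2 * ENNReal.ofReal ((x - θ) ^ 2) + ENNReal.ofReal (2 * (θ - μ) ^ 2) := by
  rw [← ENNReal.ofReal_ofNat 2, ← ENNReal.ofReal_mul (by norm_num),
    ← ENNReal.ofReal_add (by positivity) (by positivity)]
  apply ENNReal.ofReal_le_ofReal
  nlinarith [sq_nonneg (x - θ - (θ - μ))]

/-- The quadratic loss at `μ` of the estimator `est` applied to a random subsample of the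
histogram `N`. -/
noncomputable def subsampleLoss {k : ℕ} (m : ℝ) (est : (Fin k → ℕ) → ℝ) (μ : ℝ) (N : Fin k → ℕ) :
    ℝ≥0∞ :=
  ∑' N', subsampleKernel m N N' * ENNReal.ofReal ((est N' - μ) ^ 2)

/-- No estimate is close to both `μ` and `μ'`: the two squared losses add up to at least `(μ - μ') ^
2 / 2` for every subsample. -/
lemma ofReal_mul_tsum_subsampleKernel_le {k : ℕ} (m : ℝ) (est : (Fin k → ℕ) → ℝ) (μ μ' : ℝ)
    (N : Fin k → ℕ) :
    ENNReal.ofReal ((μ - μ') ^ 2 / 2) * ∑' N', subsampleKernel m N N'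
      ≤ subsampleLoss m est μ N + subsampleLoss m est μ' N := by
  unfold subsampleLoss
  rw [← ENNReal.tsum_add, ← ENNReal.tsum_mul_left]
  refine ENNReal.tsum_le_tsum fun N' => ?_
  rw [← mul_add, mul_comm, ← ENNReal.ofReal_add (by positivity) (by positivity)]
  gcongr
  nlinarith [sq_nonneg (est N' - μ + (est N' - μ'))]

/-- Normalizing the vector `P` and subsampling, a bound for the risk on the simplex gives a bound
for the loss in the model with unnormalized intensities. -/
lemma tsum_poissonProdWeight_mul_subsampleLoss_le {k : ℕ} {n m : ℝ} (hn : 0 ≤ n) (hm : 0 ≤ m)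
    (hnm : n = 0 → m = 0) {P : Fin k → ℝ} (hP : ∀ i, 0 ≤ P i) (hs : 0 < ∑ i, P i) (φ : ℝ → ℝ)
    (est : (Fin k → ℕ) → ℝ) (μ : ℝ) {R : ℝ≥0∞}
    (hR : ∀ P ∈ stdSimplex ℝ (Fin k), poissonRisk m φ est P ≤ R) :
    ∑' N, poissonProdWeight (fun i => n * P i) N * subsampleLoss m est μ N
      ≤ 2 * R + ENNReal.ofReal
        (2 * (additiveFunctional φ (fun i => P i / ∑ i, P i) - μ) ^ 2) := by
  set s := ∑ i, P i with hs'
  set Q : Fin k → ℝ := fun i => P i / s with hQ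
  have hQ0 : ∀ i, 0 ≤ Q i := fun i => div_nonneg (hP i) hs.le
  have hQmem : Q ∈ stdSimplex ℝ (Fin k) :=
    ⟨hQ0, by simp only [hQ, ← Finset.sum_div, ← hs', div_self hs.ne']⟩
  calc ∑' N, poissonProdWeight (fun i => n * P i) N * subsampleLoss m est μ N
      = ∑' N', (∑' N, poissonProdWeight (fun i => n * P i) N * subsampleKernel m N N') *
          ENNReal.ofReal ((est N' - μ) ^ 2) := by
        unfold subsampleLoss
        simp only [← ENNReal.tsum_mul_left, ← ENNReal.tsum_mul_right]
        rw [ENNReal.tsum_comm]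
        simp only [mul_assoc]
    _ ≤ ∑' N', (2 * (ENNReal.ofReal ((est N' - additiveFunctional φ Q) ^ 2) *
          poissonProdWeight (fun i => m * Q i) N') +
          poissonProdWeight (fun i => m * Q i) N' *
            ENNReal.ofReal (2 * (additiveFunctional φ Q - μ) ^ 2)) := by
        refine ENNReal.tsum_le_tsum fun N' => ?_
        refine (mul_le_mul'
          (tsum_poissonProdWeight_mul_subsampleKernel_le hn hm hnm hP hs N')
          (ofReal_sub_sq_le _ (additiveFunctional φ Q) _)).trans (le_of_eq ?_)
        ring
    _ = 2 * poissonRisk m φ est Q +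
          ENNReal.ofReal (2 * (additiveFunctional φ Q - μ) ^ 2) := by
        rw [ENNReal.tsum_add, ENNReal.tsum_mul_left, ENNReal.tsum_mul_right,
          tsum_poissonProdWeight fun i => mul_nonneg hm (hQ0 i), one_mul,
          poissonRisk_eq_tsum hm φ est hQ0]
    _ ≤ _ := by gcongr; exact hR Q hQmem

namespace AtomicLaw

variable {I : Set ℝ}

/-- The mixture of Poisson product weights over the set `G` of atoms. -/
noncomputable def partialMixture (A : AtomicLaw I) (c n : ℝ) {r : ℕ}
    (G : Finset (Fin (r + 1) → A.ι)) (N : Fin (r + 1) → ℕ) : ℝ≥0∞ :=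
  ∑ a ∈ G, ENNReal.ofReal (A.prodWeight a) * poissonProdWeight (fun i => n * A.vector c a i) N

lemma vector_nonneg (A : AtomicLaw I) (hI : ∀ x ∈ I, 0 ≤ x) {c : ℝ} (hc : 0 ≤ c) {r : ℕ}
    (a : Fin (r + 1) → A.ι) (i : Fin (r + 1)) : 0 ≤ A.vector c a i := by
  unfold vector
  split_ifs
  exacts [hc, hI _ (A.x_mem _)]

lemma tsum_partialMixture_mul (A : AtomicLaw I) (c n : ℝ) {r : ℕ}
    (G : Finset (Fin (r + 1) → A.ι)) (h : (Fin (r + 1) → ℕ) → ℝ≥0∞) :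
    ∑' N, A.partialMixture c n G N * h N = ∑ a ∈ G, ENNReal.ofReal (A.prodWeight a) *
      ∑' N, poissonProdWeight (fun i => n * A.vector c a i) N * h N := by
  unfold partialMixture
  simp only [Finset.sum_mul]
  rw [Summable.tsum_finsetSum fun _ _ => ENNReal.summable]
  simp only [mul_assoc, ENNReal.tsum_mul_left]

lemma tsum_partialMixture (A : AtomicLaw I) (hI : ∀ x ∈ I, 0 ≤ x) {c n : ℝ} (hc : 0 ≤ c)
    (hn : 0 ≤ n) {r : ℕ} (G : Finset (Fin (r + 1) → A.ι)) :
    ∑' N, A.partialMixture c n G N = ENNReal.ofReal (∑ a ∈ G, A.prodWeight a) := by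
  have := A.tsum_partialMixture_mul c n G fun _ => 1
  simp only [mul_one] at this
  rw [this, ENNReal.ofReal_sum_of_nonneg fun a _ => A.prodWeight_nonneg a]
  refine Finset.sum_congr rfl fun a _ => ?_
  rw [tsum_poissonProdWeight fun i => mul_nonneg hn (A.vector_nonneg hI hc a i), mul_one]

lemma tsum_partialMixture_mul_subsampleLoss_le (A : AtomicLaw I) (hI : ∀ x ∈ I, 0 ≤ x)
    {c n m : ℝ} (hc : 0 ≤ c) (hn : 0 ≤ n) (hm : 0 ≤ m) (hnm : n = 0 → m = 0) {r : ℕ}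
    (G : Finset (Fin (r + 1) → A.ι)) (hG : ∀ a ∈ G, 0 < ∑ i, A.vector c a i) (φ : ℝ → ℝ)
    (est : (Fin (r + 1) → ℕ) → ℝ) (μ : ℝ) {R : ℝ≥0∞}
    (hR : ∀ P ∈ stdSimplex ℝ (Fin (r + 1)), poissonRisk m φ est P ≤ R) :
    ∑' N, A.partialMixture c n G N * subsampleLoss m est μ N
      ≤ 2 * R + ENNReal.ofReal (2 * ∑ a ∈ G, A.prodWeight a *
        (additiveFunctional φ (fun i => A.vector c a i / ∑ i, A.vector c a i) - μ) ^ 2) := by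
  rw [tsum_partialMixture_mul]
  calc _ ≤ ∑ a ∈ G, ENNReal.ofReal (A.prodWeight a) * (2 * R + ENNReal.ofReal (2 *
        (additiveFunctional φ (fun i => A.vector c a i / ∑ i, A.vector c a i) - μ) ^ 2)) := by
        refine Finset.sum_le_sum fun a ha => ?_
        gcongr
        exact tsum_poissonProdWeight_mul_subsampleLoss_le hn hm hnm
          (fun i => A.vector_nonneg hI hc a i) (hG a ha) φ est μ hR
    _ = ENNReal.ofReal (∑ a ∈ G, A.prodWeight a) * (2 * R) + ENNReal.ofReal (2 *
        ∑ a ∈ G, A.prodWeight a *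
        (additiveFunctional φ (fun i => A.vector c a i / ∑ i, A.vector c a i) - μ) ^ 2) := by
        simp only [mul_add]
        rw [Finset.sum_add_distrib, ← Finset.sum_mul,
          ← ENNReal.ofReal_sum_of_nonneg fun a _ => A.prodWeight_nonneg a, Finset.mul_sum,
          ENNReal.ofReal_sum_of_nonneg fun a _ =>
            mul_nonneg zero_le_two (mul_nonneg (A.prodWeight_nonneg a) (sq_nonneg _))]
        congr 1
        refine Finset.sum_congr rfl fun a _ => ?_
        rw [← ENNReal.ofReal_mul (A.prodWeight_nonneg a), mul_left_comm]
    _ ≤ _ := by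
        refine add_le_add (mul_le_of_le_one_left' ?_) le_rfl
        rw [ENNReal.ofReal_le_one, ← A.sum_prodWeight (r + 1)]
        exact Finset.sum_le_sum_of_subset_of_nonneg (Finset.subset_univ _)
          fun a _ _ => A.prodWeight_nonneg a

/-- The two mixtures overlap up to their total variation distance, the mass of the excluded atoms
and the probability that subsampling fails. -/
lemma one_le_tsum_min_partialMixture {b : ℝ} (A B : AtomicLaw (Set.Icc 0 b)) (hb : 0 ≤ b)
    {c n : ℝ} (hc : 0 ≤ c) (hn : 0 ≤ n) {L : ℕ} (hL : 0 < L)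
    (hmom : ∀ l ≤ L, A.mean (fun x => x ^ l) = B.mean (fun x => x ^ l)) {r : ℕ}
    (G : Finset (Fin (r + 1) → A.ι)) (H : Finset (Fin (r + 1) → B.ι))
    (hG : ∀ a ∈ G, 4 / 5 ≤ ∑ i, A.vector c a i) {β β' : ℝ} (hβ : 0 ≤ β) (hβ' : 0 ≤ β')
    (hGβ : 1 - β ≤ ∑ a ∈ G, A.prodWeight a) (hHβ : 1 - β' ≤ ∑ a ∈ H, B.prodWeight a) :
    1 ≤ ∑' N, min (A.partialMixture c n G N) (B.partialMixture c n H N) *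
        ∑' N', subsampleKernel (n / 2) N N' + ENNReal.ofReal
          (r * (2 * Real.exp 1 * (n * b) / L) ^ L + β + β' + Real.exp (-n / 32)) := by
  classical
  have hI : ∀ x ∈ Set.Icc 0 b, 0 ≤ x := fun x hx => hx.1
  set q := A.partialMixture c n G
  set q' := B.partialMixture c n H
  set u := A.partialMixture c n Gᶜ
  set u' := B.partialMixture c n Hᶜ
  set D : (Fin (r + 1) → ℕ) → ℝ≥0∞ := fun N =>
    A.partialMixture c n Finset.univ N - B.partialMixture c n Finset.univ N
  set κ : (Fin (r + 1) → ℕ) → ℝ≥0∞ := fun N => ∑' N', subsampleKernel (n / 2) N N'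
  set t : (Fin (r + 1) → ℕ) → ℝ≥0∞ := fun N => poissonTail (n / 2) (∑ i, N i)
  have hsplit (N) : q N + u N = A.partialMixture c n Finset.univ N :=
    Finset.sum_add_sum_compl _ _
  have hsplit' (N) : q' N + u' N = B.partialMixture c n Finset.univ N :=
    Finset.sum_add_sum_compl _ _
  have hκ (N) : 1 ≤ κ N + t N :=
    one_le_tsum_subsampleKernel_add_poissonTail (by linarith) N
  -- The smaller of `q` and `q'` is kept, and its failure mass is at most `q * t` in both cases.
  -- Hence the lower bound on the total is needed on `G` only.
  have hpt (N) : A.partialMixture c n Finset.univ N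
      ≤ min (q N) (q' N) * κ N + (D N + u' N + u N + q N * t N) := by
    rcases le_total (q N) (q' N) with hle | hle
    · rw [min_eq_left hle, ← hsplit]
      calc q N + u N ≤ q N * (κ N + t N) + u N := by
            gcongr; exact le_mul_of_one_le_right' (hκ N)
        _ = q N * κ N + (u N + q N * t N) := by ring
        _ ≤ _ := by gcongr; exact le_add_self
    · rw [min_eq_right hle]
      calc A.partialMixture c n Finset.univ N
          ≤ D N + B.partialMixture c n Finset.univ N := le_tsub_add
        _ = D N + (q' N + u' N) := by rw [hsplit']
        _ ≤ D N + (q' N * (κ N + t N) + u' N) := by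
            gcongr; exact le_mul_of_one_le_right' (hκ N)
        _ = q' N * κ N + (D N + u' N + q' N * t N) := by ring
        _ ≤ q' N * κ N + (D N + u' N + u N + q N * t N) := by
            exact add_le_add le_rfl (add_le_add le_self_add (mul_le_mul' hle le_rfl))
  have hcompl (E : AtomicLaw (Set.Icc 0 b)) (F : Finset (Fin (r + 1) → E.ι)) (β : ℝ)
      (hF : 1 - β ≤ ∑ a ∈ F, E.prodWeight a) :
      ∑' N, E.partialMixture c n Fᶜ N ≤ ENNReal.ofReal β := by
    rw [E.tsum_partialMixture hI hc hn]
    apply ENNReal.ofReal_le_ofReal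
    have := Finset.sum_add_sum_compl F E.prodWeight
    rw [E.sum_prodWeight] at this
    linarith
  have hD : ∑' N, D N ≤ ENNReal.ofReal (r * (2 * Real.exp 1 * (n * b) / L) ^ L) := by
    have hone (E : AtomicLaw (Set.Icc 0 b)) (i : Fin (r + 1)) :
        ∑' j, (if i = 0 then poissonWeight (n * c) j else E.poissonMixture n j) = 1 := by
      split_ifs
      exacts [tsum_poissonWeight (mul_nonneg hn hc), E.tsum_poissonMixture hI hn]
    calc ∑' N, D N = ∑' N : Fin (r + 1) → ℕ,
          (∏ i, (if i = 0 then poissonWeight (n * c) (N i) else A.poissonMixture n (N i)) -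
          ∏ i, (if i = 0 then poissonWeight (n * c) (N i) else B.poissonMixture n (N i))) :=
          tsum_congr fun N => by
            rw [← sum_prodWeight_mul_poissonProdWeight, ← sum_prodWeight_mul_poissonProdWeight]
            rfl
      _ ≤ _ := tsum_prod_sub_prod_le
          (fun i j => if i = 0 then poissonWeight (n * c) j else A.poissonMixture n j)
          (fun i j => if i = 0 then poissonWeight (n * c) j else B.poissonMixture n j)
          (hone A) (hone B)
      _ = r * ∑' j, (A.poissonMixture n j - B.poissonMixture n j) := by
          simp [Fin.sum_univ_succ]
      _ ≤ r * ENNReal.ofReal ((2 * Real.exp 1 * (n * b) / L) ^ L) := by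
          gcongr; exact tsum_poissonMixture_sub_le A B hb hn hL hmom
      _ = _ := by rw [ENNReal.ofReal_mul (by positivity), ENNReal.ofReal_natCast]
  have ht : ∑' N, q N * t N ≤ ENNReal.ofReal (Real.exp (-n / 32)) := by
    rw [tsum_partialMixture_mul]
    calc _ ≤ ∑ a ∈ G, ENNReal.ofReal (A.prodWeight a) * ENNReal.ofReal (Real.exp (-n / 32)) := by
          refine Finset.sum_le_sum fun a ha => ?_
          gcongr
          rw [tsum_poissonProdWeight_mul fun i => mul_nonneg hn (A.vector_nonneg hI hc a i),
            ← Finset.mul_sum]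
          exact tsum_poissonWeight_mul_poissonTail_le hn
            (mul_le_mul_of_nonneg_left (hG a ha) hn)
      _ ≤ _ := by
          rw [← Finset.sum_mul, ← ENNReal.ofReal_sum_of_nonneg fun a _ => A.prodWeight_nonneg a]
          refine mul_le_of_le_one_left' ?_
          rw [ENNReal.ofReal_le_one, ← A.sum_prodWeight (r + 1)]
          exact Finset.sum_le_sum_of_subset_of_nonneg (Finset.subset_univ _)
            fun a _ _ => A.prodWeight_nonneg a
  have huniv := A.tsum_partialMixture hI hc hn (r := r) Finset.univ
  rw [A.sum_prodWeight, ENNReal.ofReal_one] at huniv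
  have hexp := Real.exp_pos 1
  rw [ENNReal.ofReal_add (by positivity) (by positivity),
    ENNReal.ofReal_add (by positivity) (by positivity),
    ENNReal.ofReal_add (by positivity) (by positivity), ← huniv]
  refine (ENNReal.tsum_le_tsum hpt).trans ?_
  simp only [ENNReal.tsum_add]
  rw [add_right_comm (ENNReal.ofReal _) (ENNReal.ofReal β)]
  gcongr
  exacts [hcompl B H β' hHβ, hcompl A G β hGβ]

/-- The method of two fuzzy hypotheses for the normalized mixtures. -/
theorem ofReal_le_risk {b : ℝ} (A B : AtomicLaw (Set.Icc 0 b)) (hb : 0 ≤ b)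
    {c n : ℝ} (hc : 0 ≤ c) (hn : 0 ≤ n) {L : ℕ} (hL : 0 < L)
    (hmom : ∀ l ≤ L, A.mean (fun x => x ^ l) = B.mean (fun x => x ^ l)) {r : ℕ}
    (G : Finset (Fin (r + 1) → A.ι)) (H : Finset (Fin (r + 1) → B.ι))
    (hG : ∀ a ∈ G, 4 / 5 ≤ ∑ i, A.vector c a i) (hH : ∀ a ∈ H, 4 / 5 ≤ ∑ i, B.vector c a i)
    {β β' : ℝ} (hβ : 0 ≤ β) (hβ' : 0 ≤ β')
    (hGβ : 1 - β ≤ ∑ a ∈ G, A.prodWeight a) (hHβ : 1 - β' ≤ ∑ a ∈ H, B.prodWeight a)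
    (φ : ℝ → ℝ) (est : (Fin (r + 1) → ℕ) → ℝ) {μ μ' V : ℝ} {R : ℝ≥0∞}
    (hR : ∀ P ∈ stdSimplex ℝ (Fin (r + 1)), poissonRisk (n / 2) φ est P ≤ R)
    (hVA : ∑ a ∈ G, A.prodWeight a *
      (additiveFunctional φ (fun i => A.vector c a i / ∑ i, A.vector c a i) - μ) ^ 2 ≤ V)
    (hVB : ∑ a ∈ H, B.prodWeight a *
      (additiveFunctional φ (fun i => B.vector c a i / ∑ i, B.vector c a i) - μ') ^ 2 ≤ V) :
    ENNReal.ofReal ((μ - μ') ^ 2 / 8 *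
        (1 - (r * (2 * Real.exp 1 * (n * b) / L) ^ L + β + β' + Real.exp (-n / 32))) - V) ≤ R := by
  have hI : ∀ x ∈ Set.Icc 0 b, 0 ≤ x := fun x hx => hx.1
  have hV : 0 ≤ V := le_trans
    (Finset.sum_nonneg fun a _ => mul_nonneg (A.prodWeight_nonneg a) (sq_nonneg _)) hVA
  set δ := r * (2 * Real.exp 1 * (n * b) / L) ^ L + β + β' + Real.exp (-n / 32)
  set X := ∑' N, min (A.partialMixture c n G N) (B.partialMixture c n H N) *
        ∑' N', subsampleKernel (n / 2) N N' with hX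
  have h1 : ENNReal.ofReal (1 - δ) ≤ X := by
    have := one_le_tsum_min_partialMixture A B hb hc hn hL hmom G H hG hβ hβ' hGβ hHβ
    have hexp := Real.exp_pos 1
    have hδ : 0 ≤ δ := by positivity
    rw [ENNReal.ofReal_sub _ hδ, ENNReal.ofReal_one]
    exact tsub_le_iff_right.2 this
  -- The minimum lies below both mixtures, so the two-point inequality integrates to two losses,
  -- each at most `2 * R + 2 * V`.
  have h2 : ENNReal.ofReal ((μ - μ') ^ 2 / 2) * X ≤ 4 * R + ENNReal.ofReal (4 * V) := by
    calc ENNReal.ofReal ((μ - μ') ^ 2 / 2) * X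
        ≤ ∑' N, (A.partialMixture c n G N * subsampleLoss (n / 2) est μ N +
            B.partialMixture c n H N * subsampleLoss (n / 2) est μ' N) := by
          rw [hX, ← ENNReal.tsum_mul_left]
          refine ENNReal.tsum_le_tsum fun N => ?_
          rw [mul_left_comm]
          calc _ ≤ min (A.partialMixture c n G N) (B.partialMixture c n H N) *
                (subsampleLoss (n / 2) est μ N + subsampleLoss (n / 2) est μ' N) := by
                gcongr; exact ofReal_mul_tsum_subsampleKernel_le _ _ _ _ _
            _ ≤ _ := by
                rw [mul_add]
                gcongr
                exacts [min_le_left _ _, min_le_right _ _]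
      _ ≤ (2 * R + ENNReal.ofReal (2 * V)) + (2 * R + ENNReal.ofReal (2 * V)) := by
          rw [ENNReal.tsum_add]
          have hnm : n = 0 → n / 2 = 0 := fun h => by simp [h]
          gcongr
          · refine (A.tsum_partialMixture_mul_subsampleLoss_le hI hc hn (by linarith) hnm G
              (fun a ha => by linarith [hG a ha]) φ est μ hR).trans ?_
            gcongr
          · refine (B.tsum_partialMixture_mul_subsampleLoss_le hI hc hn (by linarith) hnm H
              (fun a ha => by linarith [hH a ha]) φ est μ' hR).trans ?_
            gcongr
      _ = _ := by
          rw [add_add_add_comm, ← ENNReal.ofReal_add (by positivity) (by positivity)]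
          ring_nf
  rcases eq_or_ne R ⊤ with rfl | hRtop
  · exact le_top
  lift R to NNReal using hRtop
  have h3 : ENNReal.ofReal ((μ - μ') ^ 2 / 2 * (1 - δ)) ≤ ENNReal.ofReal (4 * R + 4 * V) := by
    rw [ENNReal.ofReal_mul (by positivity)]
    refine (mul_le_mul_right h1 _).trans (h2.trans (le_of_eq ?_))
    rw [ENNReal.ofReal_add (by positivity) (by positivity),
      ENNReal.ofReal_mul (p := 4) (q := R) (by norm_num)]
    simp
  have h4 := (ENNReal.ofReal_le_ofReal_iff (by positivity)).1 h3
  rw [← ENNReal.ofReal_coe_nnreal]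
  apply ENNReal.ofReal_le_ofReal
  linarith

end AtomicLaw

/-! ### Duality between approximation and moment matching. -/

/-- In finite dimension the convex hull of a compact set is compact. -/
lemma IsCompact.convexHull_of_finiteDimensional {E : Type*} [NormedAddCommGroup E]
    [NormedSpace ℝ E] [FiniteDimensional ℝ E] {s : Set E} (hs : IsCompact s) :
    IsCompact (convexHull ℝ s) := by
  classical
  rcases s.eq_empty_or_nonempty with rfl | ⟨x₀, hx₀⟩
  · simp
  set d := Module.finrank ℝ E + 1
  have himage : convexHull ℝ s = (fun q : (Fin d → ℝ) × (Fin d → E) => ∑ i, q.1 i • q.2 i) ''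
      (stdSimplex ℝ (Fin d) ×ˢ Set.univ.pi fun _ => s) := by
    ext x
    constructor
    · intro hx
      -- Carathéodory: affinely independent points number at most `d`; missing ones are padded by
      -- `x₀` with weight zero.
      obtain ⟨ι, _, z, w, hz, hai, hw, hw1, rfl⟩ := eq_pos_convex_span_of_mem_convexHull hx
      have hcard : Fintype.card ι ≤ Fintype.card (Fin d) := by
        rw [Fintype.card_fin]
        exact hai.card_le_finrank_succ.trans
          (Nat.succ_le_succ (Submodule.finrank_le _))
      obtain ⟨f⟩ := Function.Embedding.nonempty_of_card_le hcard
      have hz0 (j : Fin d) (hj : j ∉ Set.range f) : Function.extend f w 0 j = 0 :=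
        Function.extend_apply' _ _ _ hj
      refine ⟨(Function.extend f w 0, Function.extend f z fun _ => x₀),
        ⟨⟨fun j => ?_, ?_⟩, fun j _ => ?_⟩, ?_⟩
      · by_cases hj : ∃ a, f a = j
        · obtain ⟨a, rfl⟩ := hj
          simpa only [f.injective.extend_apply] using (hw a).le
        · exact (hz0 j hj).ge
      · rw [← hw1]
        exact (Fintype.sum_of_injective f f.injective _ _ hz0 fun a => by
          simp [f.injective.extend_apply]).symm
      · by_cases hj : ∃ a, f a = j
        · obtain ⟨a, rfl⟩ := hj
          simp only [f.injective.extend_apply]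
          exact hz ⟨a, rfl⟩
        · simpa only [Function.extend_apply' _ _ _ hj] using hx₀
      · exact (Fintype.sum_of_injective f f.injective _ _
          (fun j hj => by simp only [hz0 j hj, zero_smul]) fun a => by
          simp [f.injective.extend_apply]).symm
    · rintro ⟨⟨w, z⟩, ⟨⟨hw, hw1⟩, hz⟩, rfl⟩
      exact mem_convexHull_of_exists_fintype w z hw hw1 (fun i => hz i trivial) rfl
  rw [himage]
  exact ((isCompact_stdSimplex ℝ (Fin d)).prod (isCompact_univ_pi fun _ => hs)).image (by fun_prop)

/-- The moment curve of degree `L`, augmented by the values of `f`. -/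
def momentCurve (L : ℕ) (f : ℝ → ℝ) (x : ℝ) : (Fin (L + 1) → ℝ) × ℝ := (fun l => x ^ (l : ℕ), f x)

lemma exists_atomicLaw_of_mem_convexHull {L : ℕ} {f : ℝ → ℝ} {I : Set ℝ}
    {z : (Fin (L + 1) → ℝ) × ℝ} (hz : z ∈ convexHull ℝ (momentCurve L f '' I)) :
    ∃ A : AtomicLaw I, (∀ l : Fin (L + 1), A.mean (fun x => x ^ (l : ℕ)) = z.1 l) ∧
      A.mean f = z.2 := by
  obtain ⟨ι, hι, w, y, hw0, hw1, hy, rfl⟩ := mem_convexHull_iff_exists_fintype.1 hz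
  choose x hxI hx using hy
  refine ⟨⟨ι, hι, w, x, hw0, hw1, hxI⟩, fun l => ?_, ?_⟩
  · simp [AtomicLaw.mean, ← hx, momentCurve, Prod.fst_sum]
  · simp [AtomicLaw.mean, ← hx, momentCurve, Prod.snd_sum]

/-- Duality between best polynomial approximation and moment matching. -/
lemma exists_atomicLaw_pair {L : ℕ} {f : ℝ → ℝ} {a b : ℝ} (hf : ContinuousOn f (Set.Icc a b))
    {e : ℝ} (he : 0 < e) (hE : ENNReal.ofReal e ≤ bestPolyError L f (Set.Icc a b)) :
    ∃ A B : AtomicLaw (Set.Icc a b),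
      (∀ l ≤ L, A.mean (fun x => x ^ l) = B.mean (fun x => x ^ l)) ∧
      A.mean f - B.mean f = 2 * e := by
  have hup {e' : ℝ} (p : Polynomial ℝ) (hp : p.natDegree ≤ L) (he' : e' < e)
      (h : ∀ x ∈ Set.Icc a b, |f x - p.eval x| ≤ e') : False := by
    have : bestPolyError L f (Set.Icc a b) ≤ ENNReal.ofReal e' :=
      (iInf₂_le p hp).trans (iSup₂_le fun x hx => ENNReal.ofReal_le_ofReal (h x hx))
    exact absurd (hE.trans this) (not_le.2 ((ENNReal.ofReal_lt_ofReal_iff he).2 he'))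
  obtain ⟨x₀, hx₀⟩ : (Set.Icc a b).Nonempty := by
    by_contra hne
    rw [Set.not_nonempty_iff_eq_empty] at hne
    exact hup 0 (by simp) he (by simp [hne])
  set K := convexHull ℝ (momentCurve L f '' Set.Icc a b) with hKdef
  have hcurve : ContinuousOn (momentCurve L f) (Set.Icc a b) := by
    unfold momentCurve
    fun_prop
  have hK : IsCompact K := (isCompact_Icc.image_of_continuousOn hcurve).convexHull_of_finiteDimensional
  set s : (Fin (L + 1) → ℝ) × ℝ := (0, 2 * e) with hs
  -- Two points of the hull differing by `s` are the two laws sought. Otherwise the compact convex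
  -- sets `K` and `K + s` are strictly separated, and the separating functional produces too good a
  -- polynomial.
  by_cases hmeet : ∃ z ∈ K, z + s ∈ K
  · obtain ⟨z, hz, hzs⟩ := hmeet
    obtain ⟨A, hA, hAf⟩ := exists_atomicLaw_of_mem_convexHull hzs
    obtain ⟨B, hB, hBf⟩ := exists_atomicLaw_of_mem_convexHull hz
    refine ⟨A, B, fun l hl => ?_, ?_⟩
    · have h1 := hA ⟨l, Nat.lt_succ_of_le hl⟩
      have h2 := hB ⟨l, Nat.lt_succ_of_le hl⟩
      simp only [hs, Prod.fst_add, Pi.add_apply, Pi.zero_apply, add_zero] at h1 h2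
      rw [h1, h2]
    · rw [hAf, hBf]; simp [hs]
  exfalso
  push Not at hmeet
  have hKs : IsCompact ((fun z => z + s) '' K) := hK.image (by fun_prop)
  obtain ⟨F, u, v, hFu, huv, hFv⟩ := geometric_hahn_banach_compact_closed
    (convex_convexHull ℝ _) hK
    (by
      simpa only [add_comm] using (convex_convexHull ℝ _).translate s :
        Convex ℝ ((fun z => z + s) '' K)) hKs.isClosed (by
      rw [Set.disjoint_left]
      rintro _ hz ⟨z, hz', rfl⟩
      exact hmeet z hz' hz)
  set c := F (0, 1) with hc
  set g : Fin (L + 1) → ℝ := fun l => F (Pi.single l 1, 0) with hg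
  have hFs : F s = 2 * e * c := by
    have : s = (2 * e) • ((0, 1) : (Fin (L + 1) → ℝ) × ℝ) := by simp [hs]
    rw [this, map_smul, smul_eq_mul]
  have hFcurve (x : ℝ) : F (momentCurve L f x) = ∑ l : Fin (L + 1), x ^ (l : ℕ) * g l + f x * c := by
    have : momentCurve L f x = ∑ l : Fin (L + 1), x ^ (l : ℕ) •
        ((Pi.single l 1, 0) : (Fin (L + 1) → ℝ) × ℝ) + f x • (0, 1) := by
      ext i
      · simp [momentCurve, Prod.fst_sum, Finset.sum_apply, Pi.single_apply]
      · simp [momentCurve, Prod.snd_sum]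
    rw [this, map_add, map_sum, map_smul]
    simp only [map_smul, smul_eq_mul, hg, hc]
  have hmem (x) (hx : x ∈ Set.Icc a b) : momentCurve L f x ∈ K :=
    subset_convexHull ℝ _ ⟨x, hx, rfl⟩
  have hlt (x) (hx : x ∈ Set.Icc a b) : F (momentCurve L f x) < u := hFu _ (hmem x hx)
  have hgt (x) (hx : x ∈ Set.Icc a b) : v < F (momentCurve L f x) + 2 * e * c := by
    have := hFv _ ⟨_, hmem x hx, rfl⟩
    rwa [map_add, hFs] at this
  have hcpos : 0 < c := by
    have := hlt x₀ hx₀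
    have := hgt x₀ hx₀
    by_contra! hle
    nlinarith
  -- On the curve `F` lies in `(v - 2 * e * c, u)`, an interval shorter than `2 * e * c` with
  -- midpoint `t`. Dividing by the coefficient `c` of `f` gives a polynomial with error below `e`.
  set t := (u + v - 2 * e * c) / 2 with ht
  set p : Polynomial ℝ := Polynomial.C (t / c) -
    ∑ l : Fin (L + 1), Polynomial.C (g l / c) * Polynomial.X ^ (l : ℕ) with hp
  refine hup (e' := (u - v + 2 * e * c) / (2 * c)) p ?_ ?_ fun x hx => ?_
  · refine (Polynomial.natDegree_sub_le _ _).trans (max_le (by simp) ?_)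
    exact Polynomial.natDegree_sum_le_of_forall_le _ _ fun l _ =>
      (Polynomial.natDegree_C_mul_X_pow_le _ _).trans (Nat.lt_succ_iff.1 l.2)
  · rw [div_lt_iff₀ (by positivity)]
    linarith
  · have h1 : f x - p.eval x = (F (momentCurve L f x) - t) / c := by
      rw [hFcurve, hp]
      simp only [Polynomial.eval_sub, Polynomial.eval_C, Polynomial.eval_finsetSum,
        Polynomial.eval_mul, Polynomial.eval_pow, Polynomial.eval_X]
      have : ∑ l : Fin (L + 1), g l / c * x ^ (l : ℕ) = (∑ l : Fin (L + 1), x ^ (l : ℕ) * g l) / c := by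
        rw [Finset.sum_div]
        exact Finset.sum_congr rfl fun l _ => by ring
      rw [this]
      field_simp
      ring
    rw [h1, abs_div, abs_of_pos hcpos, div_le_div_iff₀ hcpos (by positivity)]
    have := hlt x hx
    have := hgt x hx
    have : |F (momentCurve L f x) - t| ≤ (u - v + 2 * e * c) / 2 := by
      rw [abs_le, ht]; constructor <;> linarith
    nlinarith

/-! ### Tilting, and the laws given by the separation condition. -/

namespace AtomicLaw

/-- The law with density `γ / x` with respect to `A`, the rest of the mass being put at zero. -/
noncomputable def tilt {γ b : ℝ} (A : AtomicLaw (Set.Icc γ b)) (hγ : 0 < γ) (hb : 0 ≤ b) :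
    AtomicLaw (Set.Icc 0 b) where
  ι := Option A.ι
  fintype := inferInstance
  w o := o.elim (1 - A.mean fun x => γ / x) fun a => A.w a * (γ / A.x a)
  x o := o.elim 0 A.x
  w_nonneg o := by
    cases o with
    | none =>
      have : A.mean (fun x => γ / x) ≤ A.mean fun _ => 1 :=
        A.mean_mono fun x hx => div_le_one_of_le₀ hx.1 (hγ.le.trans hx.1)
      rw [A.mean_const] at this
      simpa using this
    | some a =>
      exact mul_nonneg (A.w_nonneg a) (div_nonneg hγ.le (hγ.le.trans (A.x_mem a).1))
  w_sum := by simp [Fintype.sum_option, mean]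
  x_mem o := by
    cases o with
    | none => exact ⟨le_rfl, hb⟩
    | some a => exact ⟨hγ.le.trans (A.x_mem a).1, (A.x_mem a).2⟩

/-- The atom at zero is invisible to `f`. Hence the tilted moment of order `l + 1` is `γ` times the
original moment of order `l`. -/
lemma mean_tilt {γ b : ℝ} (A : AtomicLaw (Set.Icc γ b)) (hγ : 0 < γ) (hb : 0 ≤ b) {f : ℝ → ℝ}
    (h0 : f 0 = 0) : (A.tilt hγ hb).mean f = γ * A.mean fun x => f x / x := by
  have : (A.tilt hγ hb).mean f = ∑ o : Option A.ι, (A.tilt hγ hb).w o * f ((A.tilt hγ hb).x o) :=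
    rfl
  rw [this, Fintype.sum_option]
  simp only [tilt, Option.elim, h0, mul_zero, zero_add, mean, Finset.mul_sum]
  exact Finset.sum_congr rfl fun a _ => by ring

end AtomicLaw

/-- The separation condition provides two laws with matching moments and separated means. -/
lemma SeparationCondition.exists_atomicLaw {φ : ℝ → ℝ} (hφ : ContinuousOn φ (Set.Icc 0 1))
    {k L : ℕ} {d lam : ℝ} (hk : 0 < k) (hd : 0 < d) (hlam : 0 < lam)
    (h : SeparationCondition φ k L d lam) :
    lam ≤ √(k : ℝ) / 12 ∧ ∃ A B : AtomicLaw (Set.Icc 0 (lam / k)),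
      (∀ l ≤ L, A.mean (fun x => x ^ l) = B.mean (fun x => x ^ l)) ∧
      A.mean (fun x => x) ≤ 1 / k ∧ d / k ≤ A.mean φ - B.mean φ := by
  have hk' : (1 : ℝ) ≤ k := by exact_mod_cast hk
  have hk0 : (0 : ℝ) < k := by linarith
  have hsqrt : 1 ≤ √(k : ℝ) := Real.one_le_sqrt.2 hk'
  have hsqrt' : √(k : ℝ) ≤ k := Real.sqrt_le_iff.2 ⟨hk0.le, by nlinarith⟩
  have hb : 0 ≤ lam / k := by positivity
  rcases h with ⟨hl, hE⟩ | ⟨hl, hφ0, γ, hγ, -, hkγ, hE⟩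
  · have hle : lam / k ≤ 1 := by rw [div_le_one hk0]; linarith
    obtain ⟨A, B, hmom, hAB⟩ := exists_atomicLaw_pair (L := L) (f := φ) (a := 0) (b := lam / k)
      (e := d / (2 * k)) (hφ.mono (Set.Icc_subset_Icc_right hle)) (by positivity) (by
        rw [ENNReal.ofReal_div_of_pos (by positivity)]
        refine ENNReal.div_le_of_le_mul' ?_
        simpa [ENNReal.ofReal_mul] using hE)
    refine ⟨by linarith, A, B, hmom, ?_, ?_⟩
    · calc A.mean (fun x => x) ≤ A.mean fun _ => lam / k := A.mean_mono fun x hx => hx.2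
        _ = lam / k := A.mean_const _
        _ ≤ 1 / k := by gcongr; linarith
    · rw [hAB]
      apply le_of_eq
      field_simp
  -- Tilting multiplies the gap `d / (k * γ)` in the means of `φ x / x` by `γ`, and makes the first
  -- moment equal to `γ ≤ 1 / k`.
  · have hle : lam / k ≤ 1 := by rw [div_le_one hk0]; linarith
    have hcont : ContinuousOn (fun x => φ x / x) (Set.Icc γ (lam / k)) :=
      (hφ.mono (Set.Icc_subset_Icc hγ.le hle)).div continuousOn_id
        fun x hx => (hγ.trans_le hx.1).ne'
    obtain ⟨A, B, hmom, hAB⟩ := exists_atomicLaw_pair (L := L) (e := d / (2 * k * γ)) hcont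
      (by positivity) (by
        rw [ENNReal.ofReal_div_of_pos (by positivity)]
        refine ENNReal.div_le_of_le_mul' ?_
        rw [ENNReal.ofReal_mul (by positivity)]
        simpa [ENNReal.ofReal_mul] using hE)
    have hpow (A : AtomicLaw (Set.Icc γ (lam / k))) (l : ℕ) :
        (A.tilt hγ hb).mean (fun x => x ^ (l + 1)) = γ * A.mean fun x => x ^ l := by
      rw [A.mean_tilt hγ hb (by simp)]
      congr 1
      refine Finset.sum_congr rfl fun a _ => ?_
      have : A.x a ≠ 0 := (hγ.trans_le (A.x_mem a).1).ne'
      simp only [pow_succ]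
      field_simp
    refine ⟨hl, A.tilt hγ hb, B.tilt hγ hb, fun l hl => ?_, ?_, ?_⟩
    · cases l with
      | zero => simp [AtomicLaw.mean_const]
      | succ l => rw [hpow, hpow, hmom l (by omega)]
    · have := hpow A 0
      simp only [zero_add, pow_one, pow_zero, AtomicLaw.mean_const, mul_one] at this
      rw [this, le_div_iff₀ hk0]
      linarith
    · rw [A.mean_tilt hγ hb hφ0, B.mean_tilt hγ hb hφ0, ← mul_sub, hAB]
      apply le_of_eq
      field_simp

/-! ### Concentration of the total and the effect of normalization. -/

namespace AtomicLaw

lemma abs_mean_sub_le {I : Set ℝ} (A : AtomicLaw I) {f g : ℝ → ℝ} {y : ℝ}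
    (h : ∀ x ∈ I, |f x - y| ≤ g x) : |A.mean f - y| ≤ A.mean g := by
  have hsub : A.mean f - y = A.mean fun x => f x - y := by rw [A.mean_sub, A.mean_const]
  rw [abs_le, hsub]
  constructor
  · have := A.mean_mono (f := fun x => -1 * g x) (g := fun x => f x - y)
      fun x hx => by have := (abs_le.1 (h x hx)).1; linarith
    rw [A.mean_const_mul] at this
    linarith
  · exact A.mean_mono fun x hx => (abs_le.1 (h x hx)).2

/-- Chebyshev's inequality for the total mass of `A.vector c a`. -/
lemma one_sub_le_sum_prodWeight {b : ℝ} (A : AtomicLaw (Set.Icc 0 b)) {c τ : ℝ} (hτ : 0 < τ)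
    {r : ℕ} (hc : A.vectorMean c r (fun x => x) = 1) :
    1 - r * (b / 2) ^ 2 / τ ^ 2 ≤
      ∑ a : Fin (r + 1) → A.ι with |∑ i, A.vector c a i - 1| ≤ τ, A.prodWeight a := by
  classical
  have h1 := A.sum_prodWeight_mul_vector_sq_le c r (fun x => x) (b / 2)
  rw [hc] at h1
  have h2 : A.mean (fun x => (x - b / 2) ^ 2) ≤ (b / 2) ^ 2 := by
    refine (A.mean_mono (g := fun _ => (b / 2) ^ 2) fun x hx => ?_).trans (A.mean_const _).le
    nlinarith [mul_nonneg hx.1 (sub_nonneg.2 hx.2)]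
  have h3 := Finset.sum_filter_add_sum_filter_not Finset.univ
    (fun a : Fin (r + 1) → A.ι => |∑ i, A.vector c a i - 1| ≤ τ) A.prodWeight
  rw [A.sum_prodWeight] at h3
  have h4 : (∑ a : Fin (r + 1) → A.ι with ¬ |∑ i, A.vector c a i - 1| ≤ τ, A.prodWeight a) * τ ^ 2
      ≤ r * (b / 2) ^ 2 := by
    rw [Finset.sum_mul]
    calc _ ≤ ∑ a : Fin (r + 1) → A.ι with ¬ |∑ i, A.vector c a i - 1| ≤ τ,
          A.prodWeight a * (∑ i, A.vector c a i - 1) ^ 2 := by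
          refine Finset.sum_le_sum fun a ha => ?_
          have := (not_le.1 (Finset.mem_filter.1 ha).2).le
          rw [← sq_abs (∑ i, A.vector c a i - 1)]
          have := A.prodWeight_nonneg a
          gcongr
      _ ≤ ∑ a : Fin (r + 1) → A.ι, A.prodWeight a * (∑ i, A.vector c a i - 1) ^ 2 :=
          Finset.sum_le_sum_of_subset_of_nonneg (Finset.filter_subset _ _)
            fun a _ _ => mul_nonneg (A.prodWeight_nonneg a) (sq_nonneg _)
      _ ≤ r * A.mean (fun x => (x - b / 2) ^ 2) := h1
      _ ≤ _ := by gcongr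
  have := (le_div_iff₀ (by positivity : (0 : ℝ) < τ ^ 2)).2 h4
  linarith

/-- The scaling bound is used at `x = P i / s`, where the terms `x + 1 / k` sum to 2. -/
lemma abs_additiveFunctional_div_sub_le {k : ℕ} (hk : 0 < k) {φ : ℝ → ℝ} {H : ℝ}
    (hscale : ∀ x ∈ Set.Icc (0 : ℝ) 1, ∀ s, 4 / 5 ≤ s → s ≤ 6 / 5 → s * x ≤ 1 →
      |φ (s * x) - φ x| ≤ H * |s - 1| * (x + 1 / k)) {P : Fin k → ℝ} (hP : ∀ i, P i ∈ Set.Icc 0 1)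
    (hs : |∑ i, P i - 1| ≤ 1 / 5) :
    |additiveFunctional φ (fun i => P i / ∑ i, P i) - additiveFunctional φ P|
      ≤ 2 * (H * |∑ i, P i - 1|) := by
  set s := ∑ i, P i with hsdef
  have hs' := abs_le.1 hs
  have hs0 : 0 < s := by linarith
  have hk0 : (0 : ℝ) < k := by exact_mod_cast hk
  unfold additiveFunctional
  rw [← Finset.sum_sub_distrib]
  refine (Finset.abs_sum_le_sum_abs _ _).trans ?_
  calc ∑ i, |φ (P i / s) - φ (P i)| ≤ ∑ i, H * |s - 1| * (P i / s + 1 / k) := by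
        refine Finset.sum_le_sum fun i _ => ?_
        have hle : P i ≤ s := Finset.single_le_sum (fun j _ => (hP j).1) (Finset.mem_univ i)
        have hmul : s * (P i / s) = P i := mul_div_cancel₀ _ hs0.ne'
        have := hscale (P i / s) ⟨div_nonneg (hP i).1 hs0.le, (div_le_one hs0).2 hle⟩ s
          (by linarith) (by linarith) (by rw [hmul]; exact (hP i).2)
        rwa [hmul, abs_sub_comm] at this
    _ = 2 * (H * |s - 1|) := by
        rw [← Finset.mul_sum, Finset.sum_add_distrib, ← Finset.sum_div, ← hsdef,
          div_self hs0.ne']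
        simp [hk0.ne']
        ring

/-- The mean square deviation of the functional of the normalized vector on the good atoms. -/
lemma sum_prodWeight_mul_additiveFunctional_sq_le {b : ℝ} (A : AtomicLaw (Set.Icc 0 b))
    (hb : b ≤ 1) {c τ : ℝ} (hc : c ∈ Set.Icc 0 1) (hτ : τ ≤ 1 / 5) {r : ℕ} {φ : ℝ → ℝ} {v H : ℝ}
    (hH : 0 ≤ H) (hv : ∀ x ∈ Set.Icc 0 b, |φ x - φ 0| ≤ v)
    (hscale : ∀ x ∈ Set.Icc (0 : ℝ) 1, ∀ s, 4 / 5 ≤ s → s ≤ 6 / 5 → s * x ≤ 1 →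
      |φ (s * x) - φ x| ≤ H * |s - 1| * (x + 1 / (r + 1 : ℕ))) :
    ∑ a : Fin (r + 1) → A.ι with |∑ i, A.vector c a i - 1| ≤ τ, A.prodWeight a *
      (additiveFunctional φ (fun i => A.vector c a i / ∑ i, A.vector c a i) -
        A.vectorMean c r φ) ^ 2 ≤ 8 * (H * τ) ^ 2 + 2 * (r * v ^ 2) := by
  calc _ ≤ ∑ a : Fin (r + 1) → A.ι with |∑ i, A.vector c a i - 1| ≤ τ,
        (A.prodWeight a * (8 * (H * τ) ^ 2) +
        2 * (A.prodWeight a * (∑ i, φ (A.vector c a i) - A.vectorMean c r φ) ^ 2)) := by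
        refine Finset.sum_le_sum fun a ha => ?_
        have ha' := (Finset.mem_filter.1 ha).2
        have hP (i) : A.vector c a i ∈ Set.Icc (0 : ℝ) 1 := by
          unfold vector
          split_ifs
          exacts [hc, ⟨(A.x_mem _).1, (A.x_mem _).2.trans hb⟩]
        have h1 := abs_additiveFunctional_div_sub_le r.succ_pos hscale hP (ha'.trans hτ)
        have h2 : |additiveFunctional φ (fun i => A.vector c a i / ∑ i, A.vector c a i) -
            additiveFunctional φ (A.vector c a)| ≤ 2 * (H * τ) := h1.trans (by gcongr)
        have h3 := sq_le_sq' (abs_le.1 h2).1 (abs_le.1 h2).2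
        have hW := A.prodWeight_nonneg a
        change _ ≤ _ + 2 * (A.prodWeight a *
          (additiveFunctional φ (A.vector c a) - A.vectorMean c r φ) ^ 2)
        generalize additiveFunctional φ (fun i => A.vector c a i / ∑ i, A.vector c a i) = p at *
        generalize additiveFunctional φ (A.vector c a) = q at *
        have h4 : (p - A.vectorMean c r φ) ^ 2
            ≤ 8 * (H * τ) ^ 2 + 2 * (q - A.vectorMean c r φ) ^ 2 := by
          nlinarith [sq_nonneg (p - q - (q - A.vectorMean c r φ))]
        calc _ ≤ A.prodWeight a * (8 * (H * τ) ^ 2 + 2 * (q - A.vectorMean c r φ) ^ 2) := by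
              gcongr
          _ = _ := by ring
    _ ≤ ∑ a : Fin (r + 1) → A.ι, (A.prodWeight a * (8 * (H * τ) ^ 2) +
        2 * (A.prodWeight a * (∑ i, φ (A.vector c a i) - A.vectorMean c r φ) ^ 2)) :=
        Finset.sum_le_sum_of_subset_of_nonneg (Finset.filter_subset _ _) fun a _ _ => by
          have := A.prodWeight_nonneg a
          positivity
    _ ≤ _ := by
        rw [Finset.sum_add_distrib, ← Finset.sum_mul, A.sum_prodWeight, one_mul, ← Finset.mul_sum]
        gcongr
        refine (A.sum_prodWeight_mul_vector_sq_le c r φ (φ 0)).trans ?_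
        gcongr
        refine (A.mean_mono (g := fun _ => v ^ 2) fun x hx => ?_).trans (A.mean_const _).le
        exact sq_le_sq' (abs_le.1 (hv x hx)).1 (abs_le.1 (hv x hx)).2

end AtomicLaw

/-! ### The lower bound in terms of moduli of the functional. -/

/-- The minimax lower bound obtained from two laws with matching moments. -/
theorem AtomicLaw.ofReal_le_risk_of_moduli {φ : ℝ → ℝ} {n κ lam b d : ℝ} {r L : ℕ} (hn : 0 ≤ n)
    (hκ : κ = r + 1) (hr : 0 < r) (hL : 0 < L) (hd : 0 < d) (hlam : 0 < lam) (hb : b = lam / κ)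
    (hl : lam ≤ √κ / 12) (A B : AtomicLaw (Set.Icc 0 b))
    (hmom : ∀ l ≤ L, A.mean (fun x => x ^ l) = B.mean (fun x => x ^ l))
    (hm : A.mean (fun x => x) ≤ 1 / κ) (hAB : d / κ ≤ A.mean φ - B.mean φ)
    (hpos : 0 < 7 / 8 - κ * (2 * Real.exp 1 * n * lam / (L * κ)) ^ L) {v H : ℝ}
    (hH : 0 ≤ H) (hv : ∀ x ∈ Set.Icc 0 b, |φ x - φ 0| ≤ v)
    (hgrowth : ∀ x ∈ Set.Icc (0 : ℝ) 1, |φ x - φ 0| ≤ H * (x + 1 / κ))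
    (hscale : ∀ x ∈ Set.Icc (0 : ℝ) 1, ∀ s, 4 / 5 ≤ s → s ≤ 6 / 5 → s * x ≤ 1 →
      |φ (s * x) - φ x| ≤ H * |s - 1| * (x + 1 / κ))
    (est : (Fin (r + 1) → ℕ) → ℝ) {R : ℝ≥0∞}
    (hR : ∀ P ∈ stdSimplex ℝ (Fin (r + 1)), poissonRisk (n / 2) φ est P ≤ R) :
    ENNReal.ofReal (d ^ 2 / 32 * (7 / 8 - κ * (2 * Real.exp 1 * n * lam / (L * κ)) ^ L)
      - 50 * (κ * v ^ 2 + H ^ 2 * Real.exp (-n / 32) + H ^ 2 * (lam ^ 2 / κ))) ≤ R := by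
  have hr1 : (1 : ℝ) ≤ r := by exact_mod_cast hr
  have hk0 : 0 < κ := by linarith
  have hscale' : ∀ x ∈ Set.Icc (0 : ℝ) 1, ∀ s, 4 / 5 ≤ s → s ≤ 6 / 5 → s * x ≤ 1 →
      |φ (s * x) - φ x| ≤ H * |s - 1| * (x + 1 / (r + 1 : ℕ)) := by
    push_cast
    rwa [← hκ]
  have hsq : 0 < √κ := Real.sqrt_pos.2 hk0
  have hsq2 : √κ ^ 2 = κ := Real.sq_sqrt hk0.le
  have hb0 : 0 < b := by rw [hb]; positivity
  have hb1 : b ≤ 1 := by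
    rw [hb, div_le_one hk0]
    have : √κ ≤ κ := Real.sqrt_le_iff.2 ⟨hk0.le, by nlinarith⟩
    linarith
  have hexp := Real.exp_pos 1
  have hE := Real.exp_pos (-n / 32 : ℝ)
  set E := Real.exp (-n / 32 : ℝ) with hEdef
  have hmean : A.mean (fun x => x) = B.mean (fun x => x) := by simpa using hmom 1 hL
  set m := A.mean (fun x => x) with hmdef
  have hm0 : 0 ≤ m := A.mean_nonneg fun x hx => hx.1
  have hrm : r * m ≤ 1 := by
    have : κ * m ≤ 1 := by
      calc κ * m ≤ κ * (1 / κ) := by gcongr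
        _ = 1 := mul_one_div_cancel hk0.ne'
    nlinarith
  -- Since first moments match (`1 ≤ L`), the same `c` centres both total masses at 1; it is
  -- nonnegative because `m ≤ 1 / κ`.
  set c := 1 - r * m with hc
  have hcmem : c ∈ Set.Icc (0 : ℝ) 1 := 
    ⟨by linarith, by linarith [mul_nonneg (zero_le_one.trans hr1) hm0]⟩
  -- The largest multiple for which `lam ≤ √κ / 12` forces `τ ≤ 1 / 5`. Chebyshev then excludes mass
  -- at most `25 / 576` per law, and twice that is below `1 / 8`, whence the constant `7 / 8`.
  set τ := 12 / 5 * (lam / √κ) with hτ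
  have hτ0 : 0 < τ := by positivity
  have hτ1 : τ ≤ 1 / 5 := by
    have : lam / √κ ≤ 1 / 12 := by rw [div_le_iff₀ hsq]; linarith
    linarith
  have hτ2 : τ ^ 2 = 144 / 25 * (lam ^ 2 / κ) := by
    rw [hτ, mul_pow, div_pow lam, hsq2]; norm_num
  have hβ : r * (b / 2) ^ 2 / τ ^ 2 ≤ 25 / 576 := by
    rw [div_le_iff₀ (by positivity), hτ2, hb]
    have : (r : ℝ) * (lam / κ / 2) ^ 2 = r / κ * (lam ^ 2 / κ / 4) := by
      field_simp
      norm_num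
    rw [this]
    have : r / κ ≤ 1 := by rw [div_le_one hk0]; linarith
    have h0 : 0 ≤ lam ^ 2 / κ := by positivity
    nlinarith
  have hgood (A : AtomicLaw (Set.Icc 0 b)) (hA : A.mean (fun x => x) = m) :=
    A.one_sub_le_sum_prodWeight (c := c) (r := r) hτ0
      (by unfold AtomicLaw.vectorMean; rw [hA, hc]; ring)
  have hmass (A : AtomicLaw (Set.Icc 0 b)) (a : Fin (r + 1) → A.ι)
      (ha : a ∈ ({a | |∑ i, A.vector c a i - 1| ≤ τ} : Finset (Fin (r + 1) → A.ι))) :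
      4 / 5 ≤ ∑ i, A.vector c a i := by
    have := (abs_le.1 (Finset.mem_filter.1 ha).2).1
    linarith
  have hβ0 : 0 ≤ r * (b / 2) ^ 2 / τ ^ 2 := by positivity
  refine le_trans (ENNReal.ofReal_le_ofReal ?_) (AtomicLaw.ofReal_le_risk A B hb0.le hcmem.1
    hn hL hmom _ _ (hmass A) (hmass B) hβ0 hβ0 (hgood A rfl) (hgood B hmean.symm) φ est
    hR (A.sum_prodWeight_mul_additiveFunctional_sq_le hb1 hcmem hτ1 hH hv hscale')
    (B.sum_prodWeight_mul_additiveFunctional_sq_le hb1 hcmem hτ1 hH hv hscale'))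
  set Δ := A.vectorMean c r φ - B.vectorMean c r φ with hΔ
  have hΔeq : Δ = r * (A.mean φ - B.mean φ) := by
    rw [hΔ]; unfold AtomicLaw.vectorMean; ring
  have hrk : 1 / 2 ≤ r / κ := by rw [le_div_iff₀ hk0]; linarith
  have hΔd : d / 2 ≤ Δ := by
    rw [hΔeq]
    calc d / 2 ≤ d * (r / κ) := by nlinarith
      _ = r * (d / κ) := by ring
      _ ≤ _ := by gcongr
  -- Needed to turn the failure term `Δ ^ 2 / 8 * E` into `2 * H ^ 2 * E`, free of `d`.
  have hΔH : Δ ≤ 4 * H := by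
    have hbound (A : AtomicLaw (Set.Icc 0 b)) (hA : A.mean (fun x => x) = m) :
        |A.mean φ - φ 0| ≤ H * (2 / κ) := by
      refine (A.abs_mean_sub_le (g := fun x => H * (x + 1 / κ)) fun x hx =>
        hgrowth x ⟨hx.1, hx.2.trans hb1⟩).trans ?_
      rw [A.mean_const_mul, A.mean_add, A.mean_const, hA]
      gcongr
      linarith [add_div 1 1 κ]
    have h1 := abs_le.1 (hbound A rfl)
    have h2 := abs_le.1 (hbound B hmean.symm)
    rw [hΔeq]
    calc r * (A.mean φ - B.mean φ) ≤ κ * (H * (2 / κ) + H * (2 / κ)) := by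
          gcongr
          · have : 0 < d / κ := by positivity
            linarith
          · linarith
          · linarith
      _ = 4 * H := by field_simp; ring
  set X := κ * (2 * Real.exp 1 * n * lam / (L * κ)) ^ L with hX
  have hTX : r * (2 * Real.exp 1 * (n * b) / L) ^ L ≤ X := by
    have : 2 * Real.exp 1 * (n * b) / L = 2 * Real.exp 1 * n * lam / (L * κ) := by
      rw [hb]; field_simp
    rw [this, hX]
    gcongr
    linarith
  have hd2 : d ^ 2 / 32 ≤ Δ ^ 2 / 8 := by
    have : (d / 2) ^ 2 ≤ Δ ^ 2 := by gcongr
    linarith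
  have hH2 : Δ ^ 2 / 8 ≤ 2 * H ^ 2 := by
    have : Δ ^ 2 ≤ (4 * H) ^ 2 := by gcongr; linarith
    linarith
  have hrv : r * v ^ 2 ≤ κ * v ^ 2 := by gcongr; linarith
  -- This enters with factor 8, giving `1152 / 25 < 50`; the other error terms have factor 2.
  have hHτ : (H * τ) ^ 2 = 144 / 25 * (H ^ 2 * (lam ^ 2 / κ)) := by rw [mul_pow, hτ2]; ring
  have hq : 0 ≤ H ^ 2 * (lam ^ 2 / κ) := by positivity
  have hHE : 0 ≤ H ^ 2 * E := by positivity
  have h1 : d ^ 2 / 32 * (7 / 8 - X) ≤ Δ ^ 2 / 8 * (7 / 8 - X) := by gcongr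
  have h2 : Δ ^ 2 / 8 * E ≤ 2 * H ^ 2 * E := by gcongr
  have h3 : Δ ^ 2 / 8 * (7 / 8 - X - E) ≤ Δ ^ 2 / 8 * (1 - (r * (2 * Real.exp 1 * (n * b) / L) ^ L +
      r * (b / 2) ^ 2 / τ ^ 2 + r * (b / 2) ^ 2 / τ ^ 2 + E)) :=
    mul_le_mul_of_nonneg_left (by linarith) (by positivity)
  have hκv : 0 ≤ κ * v ^ 2 := by positivity
  rw [hHτ, ← hEdef]
  linarith

/-- The minimax lower bound for a functional with explicit moduli of continuity. -/
theorem SeparationCondition.le_poissonMinimaxRisk {φ : ℝ → ℝ}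
    (hφ : ContinuousOn φ (Set.Icc 0 1)) {n k L : ℕ} {d lam : ℝ} (hk : 0 < k) (hL : 0 < L)
    (hd : 0 < d) (hlam : 0 < lam) (hsep : SeparationCondition φ k L d lam) {v H : ℝ}
    (hH : 0 ≤ H) (hv : ∀ x ∈ Set.Icc 0 (lam / k), |φ x - φ 0| ≤ v)
    (hgrowth : ∀ x ∈ Set.Icc (0 : ℝ) 1, |φ x - φ 0| ≤ H * (x + 1 / k))
    (hscale : ∀ x ∈ Set.Icc (0 : ℝ) 1, ∀ s, 4 / 5 ≤ s → s ≤ 6 / 5 → s * x ≤ 1 →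
      |φ (s * x) - φ x| ≤ H * |s - 1| * (x + 1 / k)) :
    ENNReal.ofReal (d ^ 2 / 32 * (7 / 8 - k * (2 * Real.exp 1 * n * lam / (L * k)) ^ L)
      - 50 * (k * v ^ 2 + H ^ 2 * Real.exp (-n / 32) + H ^ 2 * (lam ^ 2 / k)))
      ≤ poissonMinimaxRisk (n / 2) k φ := by
  obtain ⟨hl, A, B, hmom, hm, hAB⟩ := hsep.exists_atomicLaw hφ hk hd hlam
  have hk0 : (0 : ℝ) < k := by exact_mod_cast hk
  have hexp := Real.exp_pos 1
  have hE := Real.exp_pos (-n / 32 : ℝ)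
  set E := Real.exp (-n / 32 : ℝ)
  set X := (k : ℝ) * (2 * Real.exp 1 * n * lam / (L * k)) ^ L with hX
  have hX0 : 0 ≤ X := by positivity
  have hrest : 0 ≤ H ^ 2 * E + H ^ 2 * (lam ^ 2 / k) := by positivity
  have hv2 : 0 ≤ k * v ^ 2 := by positivity
  rcases le_or_gt (7 / 8 - X) 0 with hneg | hpos
  · rw [ENNReal.ofReal_of_nonpos]
    · exact zero_le
    have : d ^ 2 / 32 * (7 / 8 - X) ≤ 0 := mul_nonpos_of_nonneg_of_nonpos (by positivity) hneg
    linarith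
  have hmv (A : AtomicLaw (Set.Icc 0 (lam / k))) : |A.mean φ - φ 0| ≤ v :=
    (A.abs_mean_sub_le hv).trans (A.mean_const v).le
  obtain ⟨r, rfl⟩ := Nat.exists_eq_succ_of_ne_zero hk.ne'
  -- For `k = 1` no coordinate is random, but `d ≤ 2 * v` already makes the claimed bound
  -- nonpositive.
  rcases Nat.eq_zero_or_pos r with rfl | hr
  · rw [ENNReal.ofReal_of_nonpos]
    · exact zero_le
    have h1 := abs_le.1 (hmv A)
    have h2 := abs_le.1 (hmv B)
    simp only [Nat.succ_eq_add_one, zero_add, Nat.cast_one, div_one, one_mul] at *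
    have hdv : d ≤ 2 * v := by linarith
    have : d ^ 2 ≤ (2 * v) ^ 2 := by gcongr
    nlinarith [mul_nonneg (sq_nonneg d) hX0]
  refine le_iInf fun est => ?_
  exact AtomicLaw.ofReal_le_risk_of_moduli n.cast_nonneg (by push_cast; ring) hr hL hd hlam rfl hl
    A B hmom hm hAB hpos hH hv hgrowth hscale est
    (fun P hP => le_iSup₂ (f := fun P (_ : P ∈ stdSimplex ℝ (Fin (r + 1))) =>
      poissonRisk (n / 2) φ est P) P hP)

/-! ### Increments of a functional with given divergence speed. -/

/-- A function grows at most as fast as one whose derivative dominates its own. -/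
lemma abs_sub_le_of_abs_deriv_le {D : Set ℝ} (hD : Convex ℝ D) {f F f' F' : ℝ → ℝ}
    (hf : ContinuousOn f D) (hF : ContinuousOn F D)
    (hf' : ∀ x ∈ interior D, HasDerivAt f (f' x) x) (hF' : ∀ x ∈ interior D, HasDerivAt F (F' x) x)
    (h : ∀ x ∈ interior D, |f' x| ≤ F' x) {x y : ℝ} (hx : x ∈ D) (hy : y ∈ D) (hxy : x ≤ y) :
    |f y - f x| ≤ F y - F x := by
  have h1 : MonotoneOn (fun x => F x - f x) D := by
    refine monotoneOn_of_hasDerivWithinAt_nonneg hD (hF.sub hf)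
      (fun x hx => ((hF' x hx).sub (hf' x hx)).hasDerivWithinAt) fun x hx => ?_
    linarith [(abs_le.1 (h x hx)).2]
  have h2 : MonotoneOn (fun x => F x + f x) D := by
    refine monotoneOn_of_hasDerivWithinAt_nonneg hD (hF.add hf)
      (fun x hx => ((hF' x hx).add (hf' x hx)).hasDerivWithinAt) fun x hx => ?_
    linarith [(abs_le.1 (h x hx)).1]
  have h3 := h1 hx hy hxy
  have h4 := h2 hx hy hxy
  simp only at h3 h4
  rw [abs_le]
  constructor <;> linarith

namespace HasDivergenceSpeed

variable {φ : ℝ → ℝ} {α : ℝ}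

/-- Integrating the bound on the second derivative twice. -/
lemma exists_abs_sub_le (hφ : HasDivergenceSpeed 2 α φ) {g ψ f : ℝ → ℝ} {C₀ : ℝ}
    (hg : ∀ p ∈ Set.Ioo (0 : ℝ) 1, HasDerivAt g (p ^ (α - 2)) p)
    (hψ : ∀ p ∈ Set.Ioo (0 : ℝ) 1, 1 ≤ ψ p)
    (hgψ : ∀ p ∈ Set.Ioo (0 : ℝ) 1, |g p - g (1 / 2)| ≤ C₀ * ψ p)
    (hf : ContinuousOn f (Set.Icc 0 1)) (hf' : ∀ p ∈ Set.Ioo (0 : ℝ) 1, HasDerivAt f (ψ p) p) :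
    ∃ C : ℝ, 0 < C ∧ ∀ x y : ℝ, 0 ≤ x → x ≤ y → y ≤ 1 → |φ y - φ x| ≤ C * (f y - f x) := by
  obtain ⟨hcont, hdiff, W, c, c', hW, hc, -, hbound⟩ := hφ
  have hopen : IsOpen (Set.Ioo (0 : ℝ) 1) := isOpen_Ioo
  have hd1 (p) (hp : p ∈ Set.Ioo (0 : ℝ) 1) : HasDerivAt φ (deriv φ p) p :=
    ((hdiff.contDiffAt (hopen.mem_nhds hp)).differentiableAt (by simp)).hasDerivAt
  have hdiff' : ContDiffOn ℝ 1 (deriv φ) (Set.Ioo 0 1) :=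
    hdiff.deriv_of_isOpen hopen (by norm_num)
  have hd2 (p) (hp : p ∈ Set.Ioo (0 : ℝ) 1) : HasDerivAt (deriv φ) (iteratedDeriv 2 φ p) p := by
    rw [iteratedDeriv_succ, iteratedDeriv_one]
    exact ((hdiff'.contDiffAt (hopen.mem_nhds hp)).differentiableAt (by simp)).hasDerivAt
  have hG (p) (hp : p ∈ Set.Ioo (0 : ℝ) 1) :
      HasDerivAt (fun p => W * g p + c * p) (W * p ^ (α - 2) + c) p := by
    have := ((hg p hp).const_mul W).add ((hasDerivAt_id p).const_mul c)
    rwa [mul_one] at this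
  have hφ' {p q : ℝ} (hp : p ∈ Set.Ioo (0 : ℝ) 1) (hq : q ∈ Set.Ioo (0 : ℝ) 1) (hpq : p ≤ q) :
      |deriv φ q - deriv φ p| ≤ (W * g q + c * q) - (W * g p + c * p) := by
    refine abs_sub_le_of_abs_deriv_le (convex_Ioo 0 1)
      (fun p hp => (hd2 p hp).continuousAt.continuousWithinAt)
      (fun p hp => (hG p hp).continuousAt.continuousWithinAt)
      (fun p hp => hd2 p (interior_subset hp)) (fun p hp => hG p (interior_subset hp))
      (fun p hp => ?_) hp hq hpq
    have := (hbound p (interior_subset hp)).2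
    rwa [show -((2 : ℕ) : ℝ) + α = α - 2 by push_cast; ring] at this
  have hhalf : (1 / 2 : ℝ) ∈ Set.Ioo (0 : ℝ) 1 := by norm_num
  have hC₀ : 0 ≤ C₀ := by
    by_contra! hneg
    have h1 := hgψ _ hhalf
    have h2 := hψ _ hhalf
    have := abs_nonneg (g (1 / 2) - g (1 / 2))
    nlinarith
  -- The derivative is compared with its value at `1 / 2`; since `1 ≤ ψ`, additive constants are
  -- absorbed into the multiple of `ψ`.
  set C := |deriv φ (1 / 2)| + W * C₀ + c + 1 with hC
  have hCpos : 0 < C := by positivity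
  have hderiv (p) (hp : p ∈ Set.Ioo (0 : ℝ) 1) : |deriv φ p| ≤ C * ψ p := by
    have h1 := abs_le.1 (hgψ p hp)
    have h2 := hψ p hp
    have h3 : |deriv φ p - deriv φ (1 / 2)| ≤ W * (C₀ * ψ p) + c := by
      rcases le_total p (1 / 2) with hle | hle
      · have h := hφ' hp hhalf hle
        rw [abs_sub_comm]
        nlinarith [hp.1, hp.2]
      · have h := hφ' hhalf hp hle
        nlinarith [hp.1, hp.2]
    have h4 := abs_sub_abs_le_abs_sub (deriv φ p) (deriv φ (1 / 2))
    have h5 : 0 ≤ (|deriv φ (1 / 2)| + c) * (ψ p - 1) :=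
      mul_nonneg (by positivity) (by linarith)
    rw [hC]
    nlinarith
  refine ⟨C, hCpos, fun x y hx hxy hy => ?_⟩
  rw [mul_sub]
  refine abs_sub_le_of_abs_deriv_le (F := fun x => C * f x) (F' := fun x => C * ψ x)
    (convex_Icc 0 1) hcont (hf.const_mul C) (fun p hp => hd1 p ?_) (fun p hp => ?_)
    (fun p hp => ?_) ⟨hx, hxy.trans hy⟩ ⟨hx.trans hxy, hy⟩ hxy
  · rwa [interior_Icc] at hp
  · rw [interior_Icc] at hp
    exact (hf' p hp).const_mul C
  · rw [interior_Icc] at hp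
    exact hderiv p hp

lemma exists_abs_sub_le_rpow (hφ : HasDivergenceSpeed 2 α φ) (hα : 0 < α) (hα1 : α < 1) :
    ∃ C : ℝ, 0 < C ∧ ∀ x y : ℝ, 0 ≤ x → x ≤ y → y ≤ 1 → |φ y - φ x| ≤ C * (y ^ α - x ^ α) := by
  have hne : α - 1 ≠ 0 := by linarith
  have h1α : 0 < 1 - α := by linarith
  obtain ⟨C, hC, h⟩ := hφ.exists_abs_sub_le (g := fun p => p ^ (α - 1) / (α - 1))
    (ψ := fun p => p ^ (α - 1)) (f := fun p => p ^ α / α)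
    (C₀ := (1 + (1 / 2 : ℝ) ^ (α - 1)) / (1 - α))
    (fun p hp => by
      convert! (Real.hasDerivAt_rpow_const (x := p) (p := α - 1) (Or.inl hp.1.ne')).div_const
        (α - 1) using 1
      rw [show α - 1 - 1 = α - 2 by ring]
      field_simp)
    (fun p hp => Real.one_le_rpow_of_pos_of_le_one_of_nonpos hp.1 hp.2.le (by linarith))
    (fun p hp => by
      have hp1 : 1 ≤ p ^ (α - 1) :=
        Real.one_le_rpow_of_pos_of_le_one_of_nonpos hp.1 hp.2.le (by linarith)
      have hh : 0 ≤ (1 / 2 : ℝ) ^ (α - 1) := by positivity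
      rw [← sub_div, abs_div, abs_of_neg (by linarith : α - 1 < 0), neg_sub, div_mul_eq_mul_div]
      gcongr
      rw [abs_le]
      constructor <;> nlinarith)
    ((continuousOn_id.rpow_const fun _ _ => Or.inr hα.le).div_const α)
    (fun p hp => by
      convert! (Real.hasDerivAt_rpow_const (x := p) (p := α) (Or.inl hp.1.ne')).div_const α using 1
      field_simp)
  refine ⟨C / α, by positivity, fun x y hx hxy hy => (h x y hx hxy hy).trans (le_of_eq ?_)⟩
  field_simp

/-- The derivative grows at most like `-log p`. The shift in `ψ = 1 - log p` ensures `1 ≤ ψ`, and `p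
* (2 - log p)` is its primitive. -/
lemma exists_abs_sub_le_mul_log (hφ : HasDivergenceSpeed 2 1 φ) :
    ∃ C : ℝ, 0 < C ∧ ∀ x y : ℝ, 0 ≤ x → x ≤ y → y ≤ 1 →
      |φ y - φ x| ≤ C * (y * (2 - Real.log y) - x * (2 - Real.log x)) := by
  have hlog2 : 0 < Real.log 2 := Real.log_pos (by norm_num)
  refine hφ.exists_abs_sub_le (g := Real.log) (ψ := fun p => 1 - Real.log p)
    (f := fun p => p * (2 - Real.log p)) (C₀ := 1 + Real.log 2)
    (fun p hp => ?_) (fun p hp => ?_) (fun p hp => ?_) ?_ (fun p hp => ?_)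
  · convert! Real.hasDerivAt_log hp.1.ne' using 1
    rw [show (1 : ℝ) - 2 = -1 by norm_num, Real.rpow_neg_one]
  · have := Real.log_neg hp.1 hp.2
    linarith
  · have := Real.log_neg hp.1 hp.2
    rw [one_div, Real.log_inv, abs_le]
    constructor <;> nlinarith
  · have : (fun p : ℝ => p * (2 - Real.log p)) = fun p => 2 * p - p * Real.log p := by
      ext p; ring
    rw [this]
    exact ((continuous_const.mul continuous_id).sub Real.continuous_mul_log).continuousOn
  · convert! (hasDerivAt_id p).mul ((Real.hasDerivAt_log hp.1.ne').const_sub 2) using 1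
    have := hp.1.ne'
    simp only [id]
    field_simp
    ring

lemma exists_abs_sub_le_mul (hφ : HasDivergenceSpeed 2 α φ) (hα : 1 < α) :
    ∃ C : ℝ, 0 < C ∧ ∀ x y : ℝ, 0 ≤ x → x ≤ y → y ≤ 1 → |φ y - φ x| ≤ C * (y - x) := by
  have hne : α - 1 ≠ 0 := by linarith
  refine hφ.exists_abs_sub_le (g := fun p => p ^ (α - 1) / (α - 1)) (ψ := fun _ => 1)
    (f := fun p => p) (C₀ := 1 / (α - 1)) (fun p hp => ?_) (fun _ _ => le_rfl) (fun p hp => ?_)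
    continuousOn_id fun p _ => hasDerivAt_id p
  · convert! (Real.hasDerivAt_rpow_const (x := p) (p := α - 1) (Or.inl hp.1.ne')).div_const
      (α - 1) using 1
    rw [show α - 1 - 1 = α - 2 by ring]
    field_simp
  · have hle {p : ℝ} (hp : p ∈ Set.Ioo (0 : ℝ) 1) : 0 ≤ p ^ (α - 1) ∧ p ^ (α - 1) ≤ 1 :=
      ⟨Real.rpow_nonneg hp.1.le _, Real.rpow_le_one hp.1.le hp.2.le (by linarith)⟩
    have h1 := hle hp
    have h2 := hle (p := 1 / 2) (by norm_num)
    rw [← sub_div, abs_div, abs_of_pos (by linarith : 0 < α - 1), mul_one]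
    gcongr
    rw [abs_le]
    constructor <;> linarith

end HasDivergenceSpeed

/-! ### Growth and scaling of the comparison functions. -/

/-- Split at `1 / k`: below it `x ^ α` is at most its value there; above it `x ^ α = x * (1 / x) ^
(1 - α)` with `1 / x ≤ k`. -/
lemma rpow_le_rpow_mul_add {α : ℝ} (hα : 0 < α) (hα1 : α < 1) {k : ℝ} (hk : 0 < k) {x : ℝ}
    (hx : 0 ≤ x) : x ^ α ≤ k ^ (1 - α) * (x + 1 / k) := by
  have hk1 : 0 < k ^ (1 - α) := Real.rpow_pos_of_pos hk _
  rcases le_or_gt x (1 / k) with h | h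
  · calc x ^ α ≤ (1 / k) ^ α := Real.rpow_le_rpow hx h hα.le
      _ = k ^ (1 - α) * (1 / k) := by
        rw [Real.rpow_sub hk, Real.rpow_one, Real.div_rpow zero_le_one hk.le, Real.one_rpow]
        field_simp
      _ ≤ _ := by gcongr; linarith
  · have hx0 : 0 < x := lt_trans (by positivity) h
    calc x ^ α = x * (1 / x) ^ (1 - α) := by
          rw [Real.div_rpow zero_le_one hx0.le, Real.one_rpow, Real.rpow_sub hx0, Real.rpow_one]
          field_simp
      _ ≤ x * k ^ (1 - α) := by
          gcongr
          rw [one_div_le hx0 hk]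
          exact h.le
      _ ≤ _ := by
          rw [mul_comm]
          gcongr
          have : 0 < 1 / k := by positivity
          linarith

lemma abs_rpow_sub_one_le {α s : ℝ} (hα : 0 < α) (hα1 : α < 1) (hs : 0 < s) :
    |s ^ α - 1| ≤ |s - 1| := by
  rcases le_total s 1 with h | h
  · have h1 : s ≤ s ^ α := by
      simpa using Real.rpow_le_rpow_of_exponent_ge hs h hα1.le
    have h2 : s ^ α ≤ 1 := Real.rpow_le_one hs.le h hα.le
    rw [abs_of_nonpos (by linarith), abs_of_nonpos (by linarith)]
    linarith
  · have h1 : s ^ α ≤ s := by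
      simpa using Real.rpow_le_rpow_of_exponent_le h hα1.le
    have h2 : 1 ≤ s ^ α := Real.one_le_rpow h hα.le
    rw [abs_of_nonneg (by linarith), abs_of_nonneg (by linarith)]
    linarith

/-- From `log y ≤ y - 1` at `y = 1 / (k * x)`: then `-log x ≤ log k + 1 / (k * x) - 1`. -/
lemma mul_two_sub_log_le {k : ℝ} (hk : 1 ≤ k) {x : ℝ} (hx : 0 ≤ x) :
    x * (2 - Real.log x) ≤ (1 + Real.log k) * (x + 1 / k) := by
  have hk0 : 0 < k := by linarith
  have hlk := Real.log_nonneg hk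
  rcases hx.eq_or_lt with rfl | hx
  · simp only [zero_mul, zero_add]
    positivity
  have h1 := Real.log_le_sub_one_of_pos (x := 1 / (k * x)) (by positivity)
  rw [one_div, Real.log_inv, Real.log_mul hk0.ne' hx.ne'] at h1
  have h2 : x * (2 - Real.log x) ≤ x * (1 + Real.log k + (k * x)⁻¹) := by
    gcongr; linarith
  have h3 : x * (k * x)⁻¹ = 1 / k := by field_simp
  have h4 : 0 ≤ Real.log k * (1 / k) := by positivity
  nlinarith

lemma abs_mul_two_sub_log_sub_le {k : ℝ} (hk : 1 ≤ k) {x s : ℝ} (hx : 0 ≤ x) (hx1 : x ≤ 1)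
    (hs : 4 / 5 ≤ s) (hs' : s ≤ 6 / 5) :
    |s * x * (2 - Real.log (s * x)) - x * (2 - Real.log x)|
      ≤ 3 * ((1 + Real.log k) * |s - 1| * (x + 1 / k)) := by
  have hk0 : 0 < k := by linarith
  have hlk := Real.log_nonneg hk
  rcases hx.eq_or_lt with rfl | hx
  · simp only [zero_mul, mul_zero, sub_self, abs_zero]
    positivity
  have hs0 : 0 < s := by linarith
  have h1 := mul_two_sub_log_le hk hx.le
  have hlx := Real.log_nonpos hx.le hx1
  have hf0 : 0 ≤ x * (2 - Real.log x) := mul_nonneg hx.le (by linarith)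
  have hlog : |s * Real.log s| ≤ 2 * |s - 1| := by
    have h2 := Real.log_le_sub_one_of_pos hs0
    have h3 := Real.log_le_sub_one_of_pos (x := s⁻¹) (by positivity)
    rw [Real.log_inv] at h3
    have h4 : s * s⁻¹ = 1 := mul_inv_cancel₀ hs0.ne'
    have h5 : s - 1 ≤ s * Real.log s := by nlinarith
    have h6 : s * Real.log s ≤ s * (s - 1) := by nlinarith
    rw [abs_le]
    rcases le_total 1 s with h | h
    · rw [abs_of_nonneg (by linarith)]; constructor <;> nlinarith
    · rw [abs_of_nonpos (by linarith)]; constructor <;> nlinarith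
  rw [Real.log_mul hs0.ne' hx.ne',
    show s * x * (2 - (Real.log s + Real.log x)) - x * (2 - Real.log x)
      = (s - 1) * (x * (2 - Real.log x)) - x * (s * Real.log s) by ring]
  refine (abs_sub _ _).trans ?_
  rw [abs_mul (s - 1), abs_mul x (s * _), abs_of_nonneg hf0, abs_of_pos hx]
  have h7 : x ≤ (1 + Real.log k) * (x + 1 / k) := by
    have : 0 ≤ 1 / k := by positivity
    nlinarith [mul_nonneg hlk (add_nonneg hx.le this)]
  have h8 := abs_nonneg (s - 1)
  calc |s - 1| * (x * (2 - Real.log x)) + x * |s * Real.log s|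
      ≤ |s - 1| * ((1 + Real.log k) * (x + 1 / k))
        + (1 + Real.log k) * (x + 1 / k) * (2 * |s - 1|) := by gcongr
    _ = _ := by ring

/-! ### The three ranges of the exponent. -/

/-- The minimax lower bound for a functional whose increments are dominated by those of `f`. -/
lemma le_poissonMinimaxRisk_of_abs_sub_le {φ f : ℝ → ℝ} (hφ : ContinuousOn φ (Set.Icc 0 1))
    {C : ℝ} (hC : 0 < C)
    (hf : ∀ x y : ℝ, 0 ≤ x → x ≤ y → y ≤ 1 → |φ y - φ x| ≤ C * (f y - f x)) (hf0 : f 0 = 0)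
    {n k L : ℕ} {d lam : ℝ} (hk : 0 < k) (hL : 0 < L)
    (hd : 0 < d) (hlam : 0 < lam) (hsep : SeparationCondition φ k L d lam) {H : ℝ} (hH : 0 ≤ H)
    (hgrowth : ∀ x ∈ Set.Icc (0 : ℝ) 1, f x ≤ H * (x + 1 / k))
    (hscale : ∀ x ∈ Set.Icc (0 : ℝ) 1, ∀ s, 4 / 5 ≤ s → s ≤ 6 / 5 → s * x ≤ 1 →
      |f (s * x) - f x| ≤ 3 * (H * |s - 1| * (x + 1 / k))) :
    ENNReal.ofReal (d ^ 2 / 32 * (7 / 8 - k * (2 * Real.exp 1 * n * lam / (L * k)) ^ L)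
      - 450 * C ^ 2 * (k * f (lam / k) ^ 2 + H ^ 2 * Real.exp (-n / 32) + H ^ 2 * (lam ^ 2 / k)))
      ≤ poissonMinimaxRisk (n / 2) k φ := by
  have hk1 : (1 : ℝ) ≤ k := by exact_mod_cast hk
  have hk0 : (0 : ℝ) < k := by linarith
  have hmono (x y : ℝ) (hx : 0 ≤ x) (hxy : x ≤ y) (hy : y ≤ 1) : f x ≤ f y := by
    have := (abs_nonneg _).trans (hf x y hx hxy hy)
    have := nonneg_of_mul_nonneg_right this hC
    linarith
  have hb1 : lam / k ≤ 1 := by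
    have hl := (hsep.exists_atomicLaw hφ hk hd hlam).1
    rw [div_le_one hk0]
    have : √(k : ℝ) ≤ k := Real.sqrt_le_iff.2 ⟨hk0.le, by nlinarith⟩
    linarith
  have h0 (x : ℝ) (hx : x ∈ Set.Icc (0 : ℝ) 1) : |φ x - φ 0| ≤ C * f x := by
    simpa [hf0] using hf 0 x le_rfl hx.1 hx.2
  have habs (x y : ℝ) (hx : x ∈ Set.Icc (0 : ℝ) 1) (hy : y ∈ Set.Icc (0 : ℝ) 1) :
      |φ y - φ x| ≤ C * |f y - f x| := by
    rcases le_total x y with h | h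
    · exact (hf x y hx.1 h hy.2).trans (by gcongr; exact le_abs_self _)
    · rw [abs_sub_comm (φ y), abs_sub_comm (f y)]
      exact (hf y x hy.1 h hx.2).trans (by gcongr; exact le_abs_self _)
  have hE := Real.exp_pos (-n / 32 : ℝ)
  -- The factor 3 allowed in `hscale` goes into `3 * C * H`, so the constant becomes `50 * 9 = 450`.
  have := hsep.le_poissonMinimaxRisk (n := n) hφ hk hL hd hlam (v := C * f (lam / k))
    (H := 3 * C * H) (by positivity)
    (fun x hx => (h0 x ⟨hx.1, hx.2.trans hb1⟩).trans (by
      gcongr; exact hmono _ _ hx.1 hx.2 hb1))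
    (fun x hx => (h0 x hx).trans (by
      have h1 := hgrowth x hx
      have h2 : 0 ≤ H * (x + 1 / k) := mul_nonneg hH (add_nonneg hx.1 (by positivity))
      nlinarith))
    (fun x hx s hs hs' hsx => (habs x (s * x) hx ⟨mul_nonneg (by linarith) hx.1, hsx⟩).trans (by
      have h1 := hscale x hx s hs hs' hsx
      calc C * |f (s * x) - f x| ≤ C * (3 * (H * |s - 1| * (x + 1 / k))) := by gcongr
        _ = _ := by ring))
  refine le_trans (ENNReal.ofReal_le_ofReal ?_) this
  have : 0 ≤ C ^ 2 * (k * f (lam / k) ^ 2) := by positivity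
  nlinarith

theorem mainTheorem9 (φ : ℝ → ℝ) (α : ℝ) (hα : 0 < α) (hφ : HasDivergenceSpeed 2 α φ) :
    (α < 1 → ∃ W W' : ℝ, 0 < W ∧ 0 < W' ∧
      ∀ (n k L : ℕ) (d lam : ℝ), 0 < k → 0 < L → 0 < d → 0 < lam →
        SeparationCondition φ k L d lam →
        ENNReal.ofReal
          (d ^ 2 / 32 * (7 / 8 - k * (2 * Real.exp 1 * n * lam / (L * k)) ^ L)
            - W * (k : ℝ) ^ (1 - 2 * α) * lam ^ (2 * α)
            - W' * (k : ℝ) ^ (2 - 2 * α) * Real.exp (-n / 32)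
            - (4 : ℝ) ^ (2 * α) * W' * (k : ℝ) ^ (2 - 2 * α) * (k : ℝ) ^ (-α) * lam ^ (2 * α))
          ≤ poissonMinimaxRisk (n / 2) k φ) ∧
    (α = 1 → ∃ W W' : ℝ, 0 < W ∧ 0 < W' ∧
      ∀ (n k L : ℕ) (d lam : ℝ), 0 < k → 0 < L → 0 < d → 0 < lam →
        SeparationCondition φ k L d lam →
        ENNReal.ofReal
          (d ^ 2 / 32 * (7 / 8 - k * (2 * Real.exp 1 * n * lam / (L * k)) ^ L)
            - W * lam ^ 2 * Real.log (lam / (Real.exp 1 * k)) ^ 2 / k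
            - W' * Real.log (Real.exp 1 * k) ^ 2 * Real.exp (-n / 32)
            - 16 * W' * (lam ^ 2 / k) * Real.log (Real.exp 1 * k) ^ 2
            - W' * (1 + 4 * lam / √(k : ℝ)) ^ 2 * Real.log (1 + 4 * lam / √(k : ℝ)) ^ 2)
          ≤ poissonMinimaxRisk (n / 2) k φ) ∧
    (1 < α → α < 2 → ∃ W W' : ℝ, 0 < W ∧ 0 < W' ∧
      ∀ (n k L : ℕ) (d lam : ℝ), 0 < k → 0 < L → 0 < d → 0 < lam →
        SeparationCondition φ k L d lam →
        ENNReal.ofReal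
          (d ^ 2 / 32 * (7 / 8 - k * (2 * Real.exp 1 * n * lam / (L * k)) ^ L)
            - W * (k : ℝ) ^ (1 - 2 * α) * lam ^ (2 * α)
            - W' * Real.exp (-n / 32)
            - 16 * W' * (lam ^ 2 / k))
          ≤ poissonMinimaxRisk (n / 2) k φ) := by
  refine ⟨fun hα1 => ?_, ?_, fun hα1 _ => ?_⟩
  · obtain ⟨C, hC, hf⟩ := hφ.exists_abs_sub_le_rpow hα hα1
    refine ⟨450 * C ^ 2, 450 * C ^ 2, by positivity, by positivity,
      fun n k L d lam hk hL hd hlam hsep => ?_⟩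
    have hk0 : (0 : ℝ) < k := by exact_mod_cast hk
    have hl := (hsep.exists_atomicLaw hφ.1 hk hd hlam).1
    refine le_trans (ENNReal.ofReal_le_ofReal ?_) (le_poissonMinimaxRisk_of_abs_sub_le hφ.1 hC hf
      (Real.zero_rpow hα.ne') hk hL hd hlam hsep (H := (k : ℝ) ^ (1 - α)) (by positivity)
      (fun x hx => rpow_le_rpow_mul_add hα hα1 hk0 hx.1) fun x hx s hs hs' hsx => ?_)
    · have e1 : (k : ℝ) * ((lam / k) ^ α) ^ 2 = (k : ℝ) ^ (1 - 2 * α) * lam ^ (2 * α) := by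
        rw [← Real.rpow_mul_natCast (by positivity), Real.div_rpow hlam.le hk0.le,
          Real.rpow_sub hk0, Real.rpow_one, Nat.cast_ofNat, mul_comm α 2]
        ring
      have e2 : ((k : ℝ) ^ (1 - α)) ^ 2 = (k : ℝ) ^ (2 - 2 * α) := by
        rw [← Real.rpow_mul_natCast hk0.le]
        congr 1
        push_cast
        ring
      -- As `lam ^ 2 / k ≤ 1` and `α < 1`, raising to the power `α` only increases it.
      have e3 : lam ^ 2 / k ≤ (k : ℝ) ^ (-α) * lam ^ (2 * α) := by
        have hle : lam ^ 2 / k ≤ 1 := by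
          rw [div_le_one hk0, ← Real.sq_sqrt hk0.le]
          have := Real.sqrt_nonneg (k : ℝ)
          gcongr
          linarith
        calc lam ^ 2 / k ≤ (lam ^ 2 / k) ^ α := by
              simpa using Real.rpow_le_rpow_of_exponent_ge (by positivity) hle hα1.le
          _ = _ := by
              rw [Real.div_rpow (by positivity) hk0.le, ← Real.rpow_natCast_mul hlam.le,
                Real.rpow_neg hk0.le, Nat.cast_ofNat]
              ring
      have e4 : (1 : ℝ) ≤ 4 ^ (2 * α) := Real.one_le_rpow (by norm_num) (by linarith)
      rw [e1, e2]
      have e5 : (k : ℝ) ^ (2 - 2 * α) * (lam ^ 2 / k)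
          ≤ 4 ^ (2 * α) * ((k : ℝ) ^ (2 - 2 * α) * ((k : ℝ) ^ (-α) * lam ^ (2 * α))) := by
        refine le_trans ?_ (le_mul_of_one_le_left (by positivity) e4)
        gcongr
      have e6 := mul_le_mul_of_nonneg_left e5 (by positivity : 0 ≤ 450 * C ^ 2)
      linarith
    · have hs0 : 0 < s := by linarith
      have h1 := rpow_le_rpow_mul_add hα hα1 hk0 hx.1
      have h2 := abs_rpow_sub_one_le hα hα1 hs0
      have h3 : 0 ≤ x ^ α := Real.rpow_nonneg hx.1 _
      rw [Real.mul_rpow hs0.le hx.1, show s ^ α * x ^ α - x ^ α = (s ^ α - 1) * x ^ α by ring,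
        abs_mul, abs_of_nonneg h3]
      calc |s ^ α - 1| * x ^ α ≤ |s - 1| * ((k : ℝ) ^ (1 - α) * (x + 1 / k)) := by gcongr
        _ = (k : ℝ) ^ (1 - α) * |s - 1| * (x + 1 / k) := by ring
        _ ≤ _ := by
          have : 0 ≤ (k : ℝ) ^ (1 - α) * |s - 1| * (x + 1 / k) :=
            mul_nonneg (by positivity) (add_nonneg hx.1 (by positivity))
          linarith
  · rintro rfl
    obtain ⟨C, hC, hf⟩ := hφ.exists_abs_sub_le_mul_log
    refine ⟨1800 * C ^ 2, 450 * C ^ 2, by positivity, by positivity,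
      fun n k L d lam hk hL hd hlam hsep => ?_⟩
    have hk1 : (1 : ℝ) ≤ k := by exact_mod_cast hk
    have hk0 : (0 : ℝ) < k := by linarith
    have hl := (hsep.exists_atomicLaw hφ.1 hk hd hlam).1
    have hlog : Real.log (Real.exp 1 * k) = 1 + Real.log k := by
      rw [Real.log_mul (Real.exp_ne_zero 1) hk0.ne', Real.log_exp]
    have hlk := Real.log_nonneg hk1
    refine le_trans (ENNReal.ofReal_le_ofReal ?_) (le_poissonMinimaxRisk_of_abs_sub_le hφ.1 hC hf
      (by simp) hk hL hd hlam hsep (H := 1 + Real.log k) (by positivity)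
      (fun x hx => mul_two_sub_log_le hk1 hx.1) fun x hx s hs hs' hsx =>
        abs_mul_two_sub_log_sub_le hk1 hx.1 hx.2 hs hs')
    have hlog' : Real.log (lam / (Real.exp 1 * k)) = Real.log (lam / k) - 1 := by
      rw [mul_comm, ← div_div, Real.log_div (by positivity) (Real.exp_ne_zero 1), Real.log_exp]
    have hb1 : lam / k ≤ 1 := by
      rw [div_le_one hk0]
      have : √(k : ℝ) ≤ k := Real.sqrt_le_iff.2 ⟨hk0.le, by nlinarith⟩
      linarith
    have hlb : Real.log (lam / k) ≤ 0 := Real.log_nonpos (by positivity) hb1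
    rw [hlog, hlog']
    have e1 : k * (lam / k * (2 - Real.log (lam / k))) ^ 2
        ≤ 4 * (lam ^ 2 * (Real.log (lam / k) - 1) ^ 2 / k) := by
      have : k * (lam / k * (2 - Real.log (lam / k))) ^ 2
          = lam ^ 2 / k * (2 - Real.log (lam / k)) ^ 2 := by field_simp
      rw [this]
      -- Because the logarithm is nonpositive, `2 - log ≤ 2 * (1 - log)`; this is the factor 4 in
      -- `1800 = 4 * 450`.
      have h2 : (2 - Real.log (lam / k)) ^ 2 ≤ 4 * (Real.log (lam / k) - 1) ^ 2 := by nlinarith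
      calc _ ≤ lam ^ 2 / k * (4 * (Real.log (lam / k) - 1) ^ 2) := by gcongr
        _ = _ := by ring
    have e2 := mul_le_mul_of_nonneg_left e1 (by positivity : 0 ≤ 450 * C ^ 2)
    have e3 : 0 ≤ 450 * C ^ 2 * (1 + 4 * lam / √(k : ℝ)) ^ 2 *
        Real.log (1 + 4 * lam / √(k : ℝ)) ^ 2 := by positivity
    have e4 : 0 ≤ 450 * C ^ 2 * (lam ^ 2 / k) * (1 + Real.log k) ^ 2 := by positivity
    have e5 : 1800 * C ^ 2 * lam ^ 2 * (Real.log (lam / k) - 1) ^ 2 / k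
        = 450 * C ^ 2 * (4 * (lam ^ 2 * (Real.log (lam / k) - 1) ^ 2 / k)) := by ring
    linarith
  · obtain ⟨C, hC, hf⟩ := hφ.exists_abs_sub_le_mul hα1
    -- Here the variance term is also `lam ^ 2 / k` and fits into the factor 16, so any positive `W`
    -- works.
    refine ⟨1, 450 * C ^ 2, one_pos, by positivity,
      fun n k L d lam hk hL hd hlam hsep => ?_⟩
    have hk0 : (0 : ℝ) < k := by exact_mod_cast hk
    have hk' : (0 : ℝ) ≤ 1 / k := by positivity
    refine le_trans (ENNReal.ofReal_le_ofReal ?_) (le_poissonMinimaxRisk_of_abs_sub_le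
      (f := fun x => x) hφ.1 hC hf rfl hk hL hd hlam hsep (H := 1) zero_le_one
      (fun x _ => by linarith) fun x hx s hs hs' hsx => ?_)
    · have e1 : k * (lam / k) ^ 2 = lam ^ 2 / k := by field_simp
      have e2 : 0 ≤ 1 * (k : ℝ) ^ (1 - 2 * α) * lam ^ (2 * α) := by positivity
      have e3 : 0 ≤ C ^ 2 * (lam ^ 2 / k) := by positivity
      rw [e1]
      linarith
    · rw [show s * x - x = (s - 1) * x by ring, abs_mul, abs_of_nonneg hx.1, one_mul]
      have := abs_nonneg (s - 1)
      nlinarith [mul_nonneg this hx.1, mul_nonneg this hk']
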